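/- Consider the following game between two cooperating players, Alice and Bob, and an oblivious adversary. There are $K\ge 2$ arms and $T\ge 1$ rounds, both known to the players. Before the game the adversary fixes losses $\ell_t:[K]\to[0,1]$ for $t=1,\dots,T$. Let $R^A_1,\dots,R^A_T,R^B_1,\dots,R^B_T$ be independent random variables, uniform on $[0,1]$ (no shared randomness). In round $t$ Alice chooses an arm $A_t\in[K]$ and Bob chooses an arm $B_t\in[K]$; they suffer the losses $$\hat\ell^A_t=\max\bigl(\ell_t(A_t),\mathbf 1\{A_t=B_t\}\bigr),\qquad \hat\ell^B_t=\max\bigl(\ell_t(B_t),\mathbf 1\{A_t=B_t\}\bigr),$$ and each player observes only his or her own suffered loss (no collision information). A two-player strategy consists of measurable rules, fixed before the game and not depending on the losses, by which $A_t$ is a function of $R^A_t$ and $(R^A_s,\hat\ell^A_s)_{s<t}$, and $B_t$ is a function of $R^B_t$ and $(R^B_s,\hat\ell^B_s)_{s<t}$. The regret is $$R_T=\max_{a\ne b}\ \mathbb E\sum_{t=1}^T\Bigl(\hat\ell^A_t+\hat\ell^B_t-\ell_t(a)-\ell_t(b)\Bigr),$$ the maximum being over all pairs of distinct arms $a,b\in[K]$.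 **Theorem.** There is a strategy with $R_T=\tilde O(KT^{3/4})$. That is, there are universal constants $C$ and $p\in\mathbb N$ such that for all $K\ge 2$ and $T\ge 1$ there is a two-player strategy which, against every loss sequence $(\ell_t)_{t\le T}$ with values in $[0,1]$, has $$R_T\le C\,K\,T^{3/4}\,\bigl(\log(KT)\bigr)^{p}.$$ -/

import Mathlib

open MeasureTheory
open scoped unitInterval

namespace TwoPlayerBandit

/-- What a player remembers after `t` rounds: for each past round, the own random number drawn
in that round and the loss that was observed. Nothing else is revealed; in particular a player
who observes the loss `1` is not told whether a collision occurred. -/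
abbrev History (t : ℕ) : Type := Fin t → I × I

/-- A strategy of one player on the arms `Fin K`: in round `t` (rounds are numbered `0, 1, …`)
the arm is a measurable function of the player's own history and of a fresh random number. -/
structure PlayerStrategy (K : ℕ) where
  act : (t : ℕ) → History t → I → Fin K
  measurable_act : ∀ t : ℕ, Measurable (fun p : History t × I => act t p.1 p.2)

/-- A strategy of the two players, Alice and Bob. -/
structure TwoPlayerStrategy (K : ℕ) where
  alice : PlayerStrategy K
  bob : PlayerStrategy K

/-- An oblivious adversary: the whole loss sequence, with losses in `[0, 1]`, fixed in advance. -/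
abbrev LossSequence (K : ℕ) : Type := ℕ → Fin K → I

/-- The random numbers of Alice (first component) and Bob (second component). -/
abbrev Sample : Type := (ℕ → I) × (ℕ → I)

/-- All random numbers are independent and uniform on `[0, 1]`, both over time and between the two
players: there is no shared randomness. -/
noncomputable def sampleMeasure : Measure Sample :=
  (Measure.infinitePi (fun _ : ℕ => (volume : Measure I))).prod
    (Measure.infinitePi (fun _ : ℕ => (volume : Measure I)))

/-- The loss suffered (and observed) by a player who plays `own` while the other player plays
`other`: the loss of the arm, replaced by `1` in case of a collision. -/
def sufferedLoss {K : ℕ} (loss : Fin K → I) (own other : Fin K) : I :=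
  max (loss own) (if own = other then 1 else 0)

/-- The histories of Alice and of Bob at the beginning of round `t`. -/
def histories {K : ℕ} (S : TwoPlayerStrategy K) (loss : LossSequence K) (w : Sample) :
    (t : ℕ) → History t × History t
  | 0 => (Fin.elim0, Fin.elim0)
  | t + 1 =>
    let h := histories S loss w t
    let a := S.alice.act t h.1 (w.1 t)
    let b := S.bob.act t h.2 (w.2 t)
    (Fin.snoc (α := fun _ => I × I) h.1 (w.1 t, sufferedLoss (loss t) a b),
      Fin.snoc (α := fun _ => I × I) h.2 (w.2 t, sufferedLoss (loss t) b a))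

/-- The arm played by Alice in round `t`. -/
def aliceArm {K : ℕ} (S : TwoPlayerStrategy K) (loss : LossSequence K) (t : ℕ) (w : Sample) :
    Fin K :=
  S.alice.act t (histories S loss w t).1 (w.1 t)

/-- The arm played by Bob in round `t`. -/
def bobArm {K : ℕ} (S : TwoPlayerStrategy K) (loss : LossSequence K) (t : ℕ) (w : Sample) :
    Fin K :=
  S.bob.act t (histories S loss w t).2 (w.2 t)

/-- The total loss of both players in the first `T` rounds, minus the total loss of the two arms
`a` and `b` in these rounds. -/
def excessLoss {K : ℕ} (S : TwoPlayerStrategy K) (loss : LossSequence K) (T : ℕ) (a b : Fin K)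
    (w : Sample) : ℝ :=
  ∑ t ∈ Finset.range T,
    ((sufferedLoss (loss t) (aliceArm S loss t w) (bobArm S loss t w) : ℝ)
      + (sufferedLoss (loss t) (bobArm S loss t w) (aliceArm S loss t w) : ℝ)
      - ((loss t a : ℝ) + (loss t b : ℝ)))

/-- The regret after `T` rounds: the maximum over all pairs of distinct arms of the expected
excess loss. -/
noncomputable def regret {K : ℕ} (S : TwoPlayerStrategy K) (loss : LossSequence K) (T : ℕ) : ℝ :=
  ⨆ p : {p : Fin K × Fin K // p.1 ≠ p.2},
    ∫ w, excessLoss S loss T p.1.1 p.1.2 w ∂sampleMeasure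

instance : IsProbabilityMeasure sampleMeasure := by
  unfold sampleMeasure; infer_instance

theorem measurable_histories {K : ℕ} (S : TwoPlayerStrategy K) (loss : LossSequence K) (t : ℕ) :
    Measurable (fun w => histories S loss w t) := by
  have hs (l : Fin K → I) : Measurable (fun p : Fin K × Fin K => sufferedLoss l p.1 p.2) :=
    measurable_of_countable _
  induction t with
  | zero => exact measurable_const
  | succ t ih =>
    have ha : Measurable (fun w : Sample => S.alice.act t (histories S loss w t).1 (w.1 t)) :=
      (S.alice.measurable_act t).comp
        (ih.fst.prodMk ((measurable_pi_apply t).comp measurable_fst))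
    have hb : Measurable (fun w : Sample => S.bob.act t (histories S loss w t).2 (w.2 t)) :=
      (S.bob.measurable_act t).comp
        (ih.snd.prodMk ((measurable_pi_apply t).comp measurable_snd))
    refine Measurable.prodMk (measurable_pi_lambda _ fun i => ?_)
      (measurable_pi_lambda _ fun i => ?_)
    · refine Fin.lastCases ?_ (fun j => ?_) i
      · simpa using (((measurable_pi_apply t).comp measurable_fst).prodMk
          ((hs (loss t)).comp (ha.prodMk hb)))
      · simpa [Function.comp_def] using (measurable_pi_apply j).comp ih.fst
    · refine Fin.lastCases ?_ (fun j => ?_) i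
      · simpa using (((measurable_pi_apply t).comp measurable_snd).prodMk
          ((hs (loss t)).comp (hb.prodMk ha)))
      · simpa [Function.comp_def] using (measurable_pi_apply j).comp ih.snd

/-- The excess loss is always integrable, so the integral in `regret` is a true expectation. -/
theorem integrable_excessLoss {K : ℕ} (S : TwoPlayerStrategy K) (loss : LossSequence K) (T : ℕ)
    (a b : Fin K) : Integrable (excessLoss S loss T a b) sampleMeasure := by
  have hs (l : Fin K → I) : Measurable (fun p : Fin K × Fin K => (sufferedLoss l p.1 p.2 : ℝ)) :=
    measurable_of_countable _
  have key (f : Sample → I) (hf : Measurable fun w => (f w : ℝ)) :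
      Integrable (fun w => (f w : ℝ)) sampleMeasure :=
    Integrable.of_bound hf.aestronglyMeasurable 1 (Filter.Eventually.of_forall fun w => by
      rw [Real.norm_eq_abs, abs_of_nonneg (f w).2.1]; exact (f w).2.2)
  unfold excessLoss
  refine integrable_finsetSum _ fun t _ => ?_
  have ha : Measurable (aliceArm S loss t) := (S.alice.measurable_act t).comp
    ((measurable_histories S loss t).fst.prodMk ((measurable_pi_apply t).comp measurable_fst))
  have hb : Measurable (bobArm S loss t) := (S.bob.measurable_act t).comp
    ((measurable_histories S loss t).snd.prodMk ((measurable_pi_apply t).comp measurable_snd))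
  exact ((key _ ((hs (loss t)).comp (ha.prodMk hb))).add
    (key _ ((hs (loss t)).comp (hb.prodMk ha)))).sub (integrable_const _)

end TwoPlayerBandit

/-! Let τ = ⌊√T⌋ + 1 and cut the time into τ blocks of τ rounds. Bob never plays arm `0` and keeps
one arm throughout a block, so within a block Alice faces an ordinary bandit in which one unknown
arm always costs 1. She restarts exponential weights in each block, on importance-weighted estimates
of the gains 1 - loss. A collision has gain zero, so her estimate for Bob's arm stays at zero, while
the prior puts almost all weight on arm `0`, where no collision is possible. Hence, whatever Bob's
arm is, she hits it with conditional probability at most 1/τ + 1/(K√τ) in each round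
(`lawA_playB_le`). Collision information is not needed, and Bob's observed losses are close to the
true ones.

Alice competes in each block with any reaction c(j) ≠ j to Bob's arm j (`sum_integral_lossA_le`).
Bob treats each block as one round of a bandit and runs a forecaster with small swap regret, so he
competes with φ(j) for every map φ of his arms (`sum_integral_lossB_le`). These two comparisons
cover every pair of arms a ≠ b (`exists_swap`). If both are available to Bob, let φ fix a and send
all other arms to b, and let Alice react to a with b and to anything else with a. The two
comparators are then always a and b in some order. If one of the arms is `0`, Alice takes it and φ
is constantly the other. Fixed comparators for each player would not suffice, since Bob may settle
on the arm meant for Alice.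

Alice loses about K√τ log(Kτ) in each of the τ blocks. Bob loses about K√τ log(Kτ) over the τ
blocks, in units of τ rounds, and the collisions add at most τ² (1/τ + 1/(K√τ)). Everything is of
order K τ^{3/2} log(Kτ), that is, K T^{3/4} up to logarithms. -/

namespace TwoPlayerBandit

/-! ### Sampling from a probability vector -/

/-- The law ∑ pᵢ δᵢ is a Markov kernel in p, and such a kernel is the image of the uniform law under
a map measurable in both variables. Joint measurability is what a strategy requires. -/
theorem exists_sampler (n : ℕ) [NeZero n] :
    ∃ f : stdSimplex ℝ (Fin n) → I → Fin n, Measurable (Function.uncurry f) ∧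
      ∀ p i, (volume : Measure I).real {u | f p u = i} = p.1 i := by
  let κ : ProbabilityTheory.Kernel (stdSimplex ℝ (Fin n)) (Fin n) :=
    { toFun := fun p => ∑ i, ENNReal.ofReal (p.1 i) • Measure.dirac i
      measurable' := by
        refine Measure.measurable_of_measurable_coe _ fun s hs => ?_
        simp only [Measure.coe_finsetSum, Finset.sum_apply, Measure.smul_apply, smul_eq_mul]
        refine Finset.measurable_sum _ fun i _ => Measurable.mul_const ?_ _
        exact ((measurable_pi_apply i).comp measurable_subtype_coe).ennreal_ofReal }
  have hκ (p) : κ p = ∑ i, ENNReal.ofReal (p.1 i) • Measure.dirac i := rfl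
  have : ProbabilityTheory.IsMarkovKernel κ := ⟨fun p => ⟨by
    rw [hκ]
    simp only [Measure.coe_finsetSum, Finset.sum_apply, Measure.smul_apply, smul_eq_mul,
      measure_univ, mul_one]
    rw [← ENNReal.ofReal_sum_of_nonneg fun i _ => p.2.1 i, p.2.2, ENNReal.ofReal_one]⟩⟩
  obtain ⟨f, hf, hm⟩ := κ.exists_measurable_map_eq_unitInterval
  refine ⟨f, hf, fun p i => ?_⟩
  have h1 : (volume : Measure I) {u | f p u = i} = κ p {i} := by
    rw [← hm, Measure.map_apply hf.of_uncurry_left (measurableSet_singleton i)]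
    rfl
  rw [Measure.real, h1, hκ]
  simp only [Measure.coe_finsetSum, Finset.sum_apply, Measure.smul_apply, smul_eq_mul,
    Measure.dirac_apply' _ (measurableSet_singleton i), Set.indicator_apply,
    Set.mem_singleton_iff, Pi.one_apply, mul_ite, mul_one, mul_zero, Finset.sum_ite_eq',
    Finset.mem_univ, if_true]
  exact ENNReal.toReal_ofReal (p.2.1 i)

/-- A measurable way to draw an index with a prescribed law from a uniform random number. -/
noncomputable def sampler (n : ℕ) [NeZero n] : stdSimplex ℝ (Fin n) → I → Fin n :=
  (exists_sampler n).choose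

theorem measurable_sampler (n : ℕ) [NeZero n] : Measurable (Function.uncurry (sampler n)) :=
  (exists_sampler n).choose_spec.1

theorem volume_sampler {n : ℕ} [NeZero n] (p : stdSimplex ℝ (Fin n)) (i : Fin n) :
    (volume : Measure I).real {u | sampler n p u = i} = p.1 i :=
  (exists_sampler n).choose_spec.2 p i

/-! ### Functions with finitely many values -/

/-- A function on the sample space with finitely many values and measurable fibres. -/
def IsSimple {β : Type*} (f : Sample → β) : Prop :=
  (Set.range f).Finite ∧ ∀ b, MeasurableSet (f ⁻¹' {b})

theorem IsSimple.measurableSet_preimage {β : Type*} {f : Sample → β} (hf : IsSimple f)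
    (s : Set β) : MeasurableSet (f ⁻¹' s) := by
  have : f ⁻¹' s = ⋃ b ∈ Set.range f ∩ s, f ⁻¹' {b} := by
    ext w; simp
  rw [this]
  exact (hf.1.subset Set.inter_subset_left).measurableSet_biUnion fun b _ => hf.2 b

theorem IsSimple.comp {β γ : Type*} {f : Sample → β} (hf : IsSimple f) (g : β → γ) :
    IsSimple fun w => g (f w) :=
  ⟨by simpa [Set.range_comp'] using (hf.1.image g), fun b => hf.measurableSet_preimage (g ⁻¹' {b})⟩

theorem IsSimple.prodMk {β γ : Type*} {f : Sample → β} {g : Sample → γ} (hf : IsSimple f)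
    (hg : IsSimple g) : IsSimple fun w => (f w, g w) := by
  refine ⟨(hf.1.prod hg.1).subset ?_, fun b => ?_⟩
  · rintro _ ⟨w, rfl⟩; exact ⟨⟨w, rfl⟩, ⟨w, rfl⟩⟩
  · have : (fun w => (f w, g w)) ⁻¹' {b} = f ⁻¹' {b.1} ∩ g ⁻¹' {b.2} := by
      ext w; simp [Prod.ext_iff]
    rw [this]
    exact (hf.2 _).inter (hg.2 _)

theorem isSimple_const {β : Type*} (b : β) : IsSimple fun _ => b :=
  ⟨Set.finite_range_const, fun _ => MeasurableSet.const _⟩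

theorem isSimple_of_measurable {β : Type*} [Finite β] [MeasurableSpace β]
    [MeasurableSingletonClass β] {f : Sample → β} (hf : Measurable f) : IsSimple f :=
  ⟨Set.toFinite _, fun b => hf (measurableSet_singleton b)⟩

theorem IsSimple.measurable {β : Type*} [MeasurableSpace β] {f : Sample → β} (hf : IsSimple f) :
    Measurable f := fun s _ => hf.measurableSet_preimage s

theorem IsSimple.integrable {f : Sample → ℝ} (hf : IsSimple f) : Integrable f sampleMeasure := by
  obtain ⟨C, hC⟩ := (hf.1.image fun x => ‖x‖).bddAbove
  exact Integrable.of_bound hf.measurable.aestronglyMeasurable C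
    (Filter.Eventually.of_forall fun w => hC ⟨f w, ⟨w, rfl⟩, rfl⟩)

/-! ### Resampling the random numbers of one round -/

/-- A product measure is determined on cylinders, and the preimage of a cylinder is the cylinder
without coordinate `t`, times a condition on the fresh number. -/
theorem measurePreserving_update (t : ℕ) :
    MeasurePreserving (fun q : (ℕ → I) × I => Function.update q.1 t q.2)
      ((Measure.infinitePi (fun _ : ℕ => (volume : Measure I))).prod volume)
      (Measure.infinitePi (fun _ : ℕ => (volume : Measure I))) := by
  have hm : Measurable (fun q : (ℕ → I) × I => Function.update q.1 t q.2) := by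
    refine measurable_pi_lambda _ fun s => ?_
    by_cases h : s = t
    · subst h; simpa using measurable_snd
    · simpa [Function.update_of_ne h, Function.comp_def] using
        (measurable_pi_apply (X := fun _ : ℕ => I) s).comp (measurable_fst (β := I))
  refine ⟨hm, Measure.eq_infinitePi _ fun s A hA => ?_⟩
  rw [Measure.map_apply hm (MeasurableSet.pi s.countable_toSet fun i _ => hA i)]
  have hpre : (fun q : (ℕ → I) × I => Function.update q.1 t q.2) ⁻¹' (Set.pi s A)
      = (Set.pi (s.erase t) A) ×ˢ (if t ∈ s then A t else Set.univ) := by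
    ext ⟨x, u⟩
    simp only [Set.mem_preimage, Set.mem_pi, Finset.mem_coe, Set.mem_prod, Finset.mem_erase]
    constructor
    · intro h
      refine ⟨fun i hi => by simpa [Function.update_of_ne hi.1] using h i hi.2, ?_⟩
      split_ifs with ht
      · simpa using h t ht
      · trivial
    · rintro ⟨h1, h2⟩ i hi
      by_cases hit : i = t
      · subst hit; simpa [hi] using h2
      · simpa [Function.update_of_ne hit] using h1 i ⟨hit, hi⟩
  rw [hpre, Measure.prod_prod, Measure.infinitePi_pi _ fun i _ => hA i]
  by_cases ht : t ∈ s
  · simp only [ht, if_true]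
    exact Finset.prod_erase_mul s (fun i => (volume : Measure I) (A i)) ht
  · simp [ht]

/-- Replace the random numbers of round `t`. -/
def resample (t : ℕ) (q : Sample × I × I) : Sample :=
  (Function.update q.1.1 t q.2.1, Function.update q.1.2 t q.2.2)

/-- This replaces conditional expectations: what is known before round `t` is unchanged by `resample
t`, so Fubini averages over the random numbers of that round alone. -/
theorem measurePreserving_resample (t : ℕ) :
    MeasurePreserving (resample t) (sampleMeasure.prod (volume.prod volume)) sampleMeasure := by
  set μ := Measure.infinitePi (fun _ : ℕ => (volume : Measure I)) with hμ
  -- `h1` to `h5` only reorder the factors, from (μ × μ) × (ν × ν) to (μ × ν) × (μ × ν), where ν is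
  -- the uniform law.
  have h1 := measurePreserving_prodAssoc μ μ ((volume : Measure I).prod (volume : Measure I))
  have h2 := (MeasurePreserving.id μ).prod
    ((measurePreserving_prodAssoc μ (volume : Measure I) (volume : Measure I)).symm)
  have h3 := (MeasurePreserving.id μ).prod
    ((Measure.measurePreserving_swap (μ := μ) (ν := (volume : Measure I))).prod
      (MeasurePreserving.id (volume : Measure I)))
  have h4 := (MeasurePreserving.id μ).prod
    (measurePreserving_prodAssoc (volume : Measure I) μ (volume : Measure I))
  have h5 := (measurePreserving_prodAssoc μ (volume : Measure I)
    (μ.prod (volume : Measure I))).symm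
  have h6 := (measurePreserving_update t).prod (measurePreserving_update t)
  exact h6.comp (h5.comp (h4.comp (h3.comp (h2.comp h1))))

/-! ### Averaging over the random numbers of one round -/

theorem integral_arms {K : ℕ} {a b : I → Fin K} (ha : Measurable a) (hb : Measurable b)
    (f : Fin K → Fin K → ℝ) :
    ∫ q : I × I, f (a q.1) (b q.2) ∂(volume.prod volume)
      = ∑ i, ∑ j, (volume : Measure I).real {u | a u = i}
          * (volume : Measure I).real {u | b u = j} * f i j := by
  have hab : Measurable (fun q : I × I => (a q.1, b q.2)) :=
    (ha.comp measurable_fst).prodMk (hb.comp measurable_snd)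
  have h1 : ∫ q : I × I, f (a q.1) (b q.2) ∂((volume : Measure I).prod volume)
      = ∫ x : Fin K × Fin K, f x.1 x.2
          ∂(Measure.map (fun q : I × I => (a q.1, b q.2)) (volume.prod volume)) :=
    (integral_map (f := fun x : Fin K × Fin K => f x.1 x.2) hab.aemeasurable
      (measurable_of_countable _).aestronglyMeasurable).symm
  have : IsProbabilityMeasure
      (Measure.map (fun q : I × I => (a q.1, b q.2)) ((volume : Measure I).prod volume)) :=
    Measure.isProbabilityMeasure_map hab.aemeasurable
  rw [h1, integral_fintype (Integrable.of_finite), Fintype.sum_prod_type]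
  refine Finset.sum_congr rfl fun i _ => Finset.sum_congr rfl fun j _ => ?_
  rw [smul_eq_mul, map_measureReal_apply hab (measurableSet_singleton _)]
  have : (fun q : I × I => (a q.1, b q.2)) ⁻¹' {(i, j)} = {u | a u = i} ×ˢ {u | b u = j} := by
    ext q; simp
  rw [this, measureReal_prod_prod]

/-- The expectation of a function of a state known before round `t` and of the two arms of round
`t` is the expectation of its average over the conditional law of the arms. -/
theorem integral_tower {K : ℕ} {X₁ X₂ : Type} {t : ℕ} {Z : Sample → X₁ × X₂}
    (hZt : ∀ q, Z (resample t q) = Z q.1) {a : X₁ → I → Fin K} {b : X₂ → I → Fin K}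
    (ha : ∀ z, Measurable (a z)) (hb : ∀ z, Measurable (b z))
    {pa : X₁ → Fin K → ℝ} {pb : X₂ → Fin K → ℝ}
    (hpa : ∀ z i, (volume : Measure I).real {u | a z u = i} = pa z i)
    (hpb : ∀ z i, (volume : Measure I).real {u | b z u = i} = pb z i)
    (hs : IsSimple fun w => (Z w, a (Z w).1 (w.1 t), b (Z w).2 (w.2 t)))
    (f : X₁ × X₂ → Fin K → Fin K → ℝ) :
    ∫ w, f (Z w) (a (Z w).1 (w.1 t)) (b (Z w).2 (w.2 t)) ∂sampleMeasure
      = ∫ w, ∑ i, ∑ j, pa (Z w).1 i * pb (Z w).2 j * f (Z w) i j ∂sampleMeasure := by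
  have hG : IsSimple fun w => f (Z w) (a (Z w).1 (w.1 t)) (b (Z w).2 (w.2 t)) :=
    hs.comp fun x => f x.1 x.2.1 x.2.2
  have hmp := measurePreserving_resample t
  have hint : Integrable (fun q => f (Z (resample t q)) (a (Z (resample t q)).1
      ((resample t q).1 t)) (b (Z (resample t q)).2 ((resample t q).2 t)))
      (sampleMeasure.prod ((volume : Measure I).prod (volume : Measure I))) :=
    hmp.integrable_comp_of_integrable hG.integrable
  rw [← hmp.map_eq, integral_map hmp.measurable.aemeasurable
    (hG.measurable.aestronglyMeasurable), integral_prod _ hint, hmp.map_eq]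
  refine integral_congr_ae (Filter.Eventually.of_forall fun w => ?_)
  simp only [hZt]
  simp only [resample, Function.update_self]
  rw [integral_arms (ha _) (hb _) (fun i j => f (Z w) i j)]
  simp only [hpa, hpb]

/-! ### Strategies given by a state machine -/

/-- A player who remembers a state, updated after each round from the own arm and the observed
loss. -/
structure Machine (K : ℕ) (X : Type) [MeasurableSpace X] where
  init : X
  act : ℕ → X → I → Fin K
  upd : ℕ → X → Fin K → I → X
  measurable_act : ∀ t, Measurable fun p : X × I => act t p.1 p.2
  measurable_upd : ∀ t, Measurable fun p : X × Fin K × I => upd t p.1 p.2.1 p.2.2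

namespace Machine

variable {K : ℕ} {X : Type} [MeasurableSpace X] (M : Machine K X)

/-- The state after a given history. -/
def state : (t : ℕ) → History t → X
  | 0, _ => M.init
  | t + 1, h => M.upd t (state t (Fin.init h)) (M.act t (state t (Fin.init h)) (h (Fin.last t)).1)
      (h (Fin.last t)).2

theorem measurable_state (t : ℕ) : Measurable (M.state t) := by
  induction t with
  | zero => exact measurable_const
  | succ t ih =>
    have h1 : Measurable fun h : History (t + 1) => M.state t (Fin.init h) :=
      ih.comp (measurable_pi_lambda _ fun i => measurable_pi_apply (Fin.castSucc i))
    have h2 : Measurable fun h : History (t + 1) => h (Fin.last t) := measurable_pi_apply _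
    exact (M.measurable_upd t).comp
      (h1.prodMk (((M.measurable_act t).comp (h1.prodMk h2.fst)).prodMk h2.snd))

/-- The strategy played by a state machine. -/
def toStrategy : PlayerStrategy K where
  act t h u := M.act t (M.state t h) u
  measurable_act t := (M.measurable_act t).comp
    (((M.measurable_state t).comp measurable_fst).prodMk measurable_snd)

theorem sum_volume_act (t : ℕ) (z : X) :
    ∑ i, (volume : Measure I).real {u | M.act t z u = i} = 1 := by
  rw [← probReal_univ (μ := (volume : Measure I))]
  have := measureReal_biUnion_finset (μ := (volume : Measure I)) (s := Finset.univ)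
    (f := fun i => {u | M.act t z u = i})
    (fun i _ j _ hij => Set.disjoint_left.2 fun u hu hv => hij (hu.symm.trans hv))
    (fun i _ => (M.measurable_act t).of_uncurry_left (measurableSet_singleton i))
  rw [← this]
  congr 1
  ext u; simp

end Machine

/-! ### Two machines playing against each other -/

theorem histories_resample {K : ℕ} (S : TwoPlayerStrategy K) (loss : LossSequence K) (t : ℕ)
    (q : Sample × I × I) {s : ℕ} (hs : s ≤ t) :
    histories S loss (resample t q) s = histories S loss q.1 s := by
  induction s with
  | zero => rfl
  | succ s ih =>
    have hst : s ≠ t := by omega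
    simp only [histories, ih (by omega)]
    simp only [resample, Function.update_of_ne hst]

section Play

variable {K : ℕ} {X₁ X₂ : Type} [MeasurableSpace X₁] [MeasurableSpace X₂]
  (A : Machine K X₁) (B : Machine K X₂) (loss : LossSequence K)

/-- The pair of strategies played by two state machines. -/
def pairStrategy : TwoPlayerStrategy K := ⟨A.toStrategy, B.toStrategy⟩

/-- The states of both players before round `t`. -/
def states (t : ℕ) (w : Sample) : X₁ × X₂ :=
  (A.state t (histories (pairStrategy A B) loss w t).1,
    B.state t (histories (pairStrategy A B) loss w t).2)

/-- Alice's arm in round `t`. -/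
def armA (t : ℕ) (w : Sample) : Fin K := aliceArm (pairStrategy A B) loss t w

/-- Bob's arm in round `t`. -/
def armB (t : ℕ) (w : Sample) : Fin K := bobArm (pairStrategy A B) loss t w

theorem armB_eq (t : ℕ) (w : Sample) :
    armB A B loss t w = B.act t (states A B loss t w).2 (w.2 t) := rfl

theorem states_succ (t : ℕ) (w : Sample) :
    states A B loss (t + 1) w =
      (A.upd t (states A B loss t w).1 (armA A B loss t w)
          (sufferedLoss (loss t) (armA A B loss t w) (armB A B loss t w)),
        B.upd t (states A B loss t w).2 (armB A B loss t w)
          (sufferedLoss (loss t) (armB A B loss t w) (armA A B loss t w))) := by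
  simp only [states, Machine.state, histories, Fin.init_snoc, Fin.snoc_last]
  rfl

theorem measurable_arms (t : ℕ) :
    Measurable fun w => (armA A B loss t w, armB A B loss t w) :=
  (((pairStrategy A B).alice.measurable_act t).comp
    ((measurable_histories _ loss t).fst.prodMk ((measurable_pi_apply t).comp measurable_fst))).prodMk
  (((pairStrategy A B).bob.measurable_act t).comp
    ((measurable_histories _ loss t).snd.prodMk ((measurable_pi_apply t).comp measurable_snd)))

/-- For fixed losses a round has finitely many outcomes, so the states take finitely many values
although they live in a continuum. Every function of them is therefore integrable, inverse
probabilities included, without any bound. -/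
theorem isSimple_play (t : ℕ) :
    IsSimple fun w => (states A B loss t w, armA A B loss t w, armB A B loss t w) := by
  have ha (t : ℕ) := isSimple_of_measurable (measurable_arms A B loss t)
  have hs : ∀ t, IsSimple (states A B loss t) := by
    intro t
    induction t with
    | zero => exact isSimple_const (A.init, B.init)
    | succ t ih =>
      have := (ih.prodMk (ha t)).comp fun x : (X₁ × X₂) × Fin K × Fin K =>
        (A.upd t x.1.1 x.2.1 (sufferedLoss (loss t) x.2.1 x.2.2),
          B.upd t x.1.2 x.2.2 (sufferedLoss (loss t) x.2.2 x.2.1))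
      convert this using 2 with w
      exact states_succ A B loss t w
  exact (hs t).prodMk (ha t)

theorem integrable_play (t : ℕ) (f : X₁ × X₂ → Fin K → Fin K → ℝ) :
    Integrable (fun w => f (states A B loss t w) (armA A B loss t w) (armB A B loss t w))
      sampleMeasure :=
  ((isSimple_play A B loss t).comp fun x => f x.1 x.2.1 x.2.2).integrable

theorem integral_play {t : ℕ} {pa : X₁ → Fin K → ℝ} {pb : X₂ → Fin K → ℝ}
    (hpa : ∀ z i, (volume : Measure I).real {u | A.act t z u = i} = pa z i)
    (hpb : ∀ z i, (volume : Measure I).real {u | B.act t z u = i} = pb z i)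
    (f : X₁ × X₂ → Fin K → Fin K → ℝ) :
    ∫ w, f (states A B loss t w) (armA A B loss t w) (armB A B loss t w) ∂sampleMeasure
      = ∫ w, ∑ i, ∑ j, pa (states A B loss t w).1 i * pb (states A B loss t w).2 j
          * f (states A B loss t w) i j ∂sampleMeasure :=
  integral_tower (Z := states A B loss t) (a := A.act t) (b := B.act t)
    (fun q => by simp only [states, histories_resample _ loss t q le_rfl])
    (fun _ => (A.measurable_act t).of_uncurry_left)
    (fun _ => (B.measurable_act t).of_uncurry_left) hpa hpb (isSimple_play A B loss t) f

/-- Averaging over Alice's arm only. -/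
theorem integral_play_alice {t : ℕ} {pa : X₁ → Fin K → ℝ}
    (hpa : ∀ z i, (volume : Measure I).real {u | A.act t z u = i} = pa z i)
    (f : X₁ × X₂ → Fin K → Fin K → ℝ) :
    ∫ w, f (states A B loss t w) (armA A B loss t w) (armB A B loss t w) ∂sampleMeasure
      = ∫ w, ∑ i, pa (states A B loss t w).1 i
          * f (states A B loss t w) i (armB A B loss t w) ∂sampleMeasure := by
  set pb : X₂ → Fin K → ℝ := fun z i => (volume : Measure I).real {u | B.act t z u = i}
  have h1 (z : X₁) : ∑ i, pa z i = 1 := by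
    simp only [← hpa, A.sum_volume_act]
  -- Both sides are averaged over both arms. The right-hand integrand no longer depends on Alice's
  -- arm, so her probabilities sum to one there.
  rw [integral_play A B loss hpa (pb := pb) (fun _ _ => rfl),
    integral_play A B loss hpa (pb := pb) (fun _ _ => rfl)
      (fun z _ j => ∑ i, pa z.1 i * f z i j)]
  congr 1
  ext w
  rw [Finset.sum_comm, Finset.sum_comm (f := fun i j => pa (states A B loss t w).1 i
    * pb (states A B loss t w).2 j * ∑ i, pa (states A B loss t w).1 i * f _ i j)]
  refine Finset.sum_congr rfl fun j _ => ?_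
  rw [← Finset.sum_mul, ← Finset.sum_mul, h1, one_mul, Finset.mul_sum]
  exact Finset.sum_congr rfl fun i _ => by ring

/-- Averaging over Bob's arm, for a function that does not depend on Alice's arm. -/
theorem integral_play_bob {t : ℕ} {pb : X₂ → Fin K → ℝ}
    (hpb : ∀ z i, (volume : Measure I).real {u | B.act t z u = i} = pb z i)
    (f : X₁ × X₂ → Fin K → ℝ) :
    ∫ w, f (states A B loss t w) (armB A B loss t w) ∂sampleMeasure
      = ∫ w, ∑ j, pb (states A B loss t w).2 j
          * f (states A B loss t w) j ∂sampleMeasure := by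
  set pa : X₁ → Fin K → ℝ := fun z i => (volume : Measure I).real {u | A.act t z u = i}
  have h1 (z : X₁) : ∑ i, pa z i = 1 := by
    simp only [pa, A.sum_volume_act]
  rw [integral_play A B loss (pa := pa) (fun _ _ => rfl) hpb fun z _ j => f z j]
  congr 1
  ext w
  rw [Finset.sum_comm]
  refine Finset.sum_congr rfl fun j _ => ?_
  rw [← Finset.sum_mul, ← Finset.sum_mul, h1, one_mul]

end Play

/-! ### Exponential weights for gains, with a prior and uniform exploration -/

/-- The unnormalised weights of the gain-based forecaster. -/
noncomputable def gainWeight {n : ℕ} (w₀ : Fin n → ℝ) (η : ℝ) (G : Fin n → ℝ) (i : Fin n) : ℝ :=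
  w₀ i * Real.exp (η * G i)

/-- Exponential weights mixed with uniform exploration. -/
noncomputable def gainProb {n : ℕ} (w₀ : Fin n → ℝ) (γ η : ℝ) (G : Fin n → ℝ) (i : Fin n) : ℝ :=
  (1 - γ) * (gainWeight w₀ η G i / ∑ j, gainWeight w₀ η G j) + γ / n

theorem gainWeight_pos {n : ℕ} {w₀ : Fin n → ℝ} {η : ℝ} (hw : ∀ i, 0 < w₀ i)
    (G : Fin n → ℝ) (i : Fin n) :
    0 < gainWeight w₀ η G i := mul_pos (hw i) (Real.exp_pos _)

theorem measurable_gainProb {n : ℕ} (w₀ : Fin n → ℝ) (γ η : ℝ) : Measurable (gainProb w₀ γ η) := by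
  refine measurable_pi_lambda _ fun i => ?_
  unfold gainProb gainWeight
  fun_prop

/-- An arm without gains has a small probability, if its prior weight is small. -/
theorem gainProb_le {n : ℕ} {w₀ : Fin n → ℝ} {γ η : ℝ} (hw : ∀ i, 0 < w₀ i) (hγ₀ : 0 ≤ γ)
    (hη : 0 ≤ η) {G : Fin n → ℝ}
    {i j : Fin n} (hi : G i = 0) (hj : 0 ≤ G j) (hwj : w₀ j = 1) :
    gainProb w₀ γ η G i ≤ w₀ i + γ / n := by
  have h1 : gainWeight w₀ η G i = w₀ i := by simp [gainWeight, hi]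
  -- An arm of prior weight 1 with nonnegative estimated gain keeps the total weight at least 1,
  -- while arm `i` still has its prior weight.
  have h2 : 1 ≤ gainWeight w₀ η G j := by
    simpa [gainWeight, hwj] using mul_nonneg hη hj
  have h3 : 1 ≤ ∑ j, gainWeight w₀ η G j :=
    h2.trans (Finset.single_le_sum (fun k _ => (gainWeight_pos hw G k).le) (Finset.mem_univ j))
  have h4 : w₀ i / ∑ j, gainWeight w₀ η G j ≤ w₀ i := div_le_self (hw i).le h3
  have h5 : 0 ≤ w₀ i / ∑ j, gainWeight w₀ η G j := div_nonneg (hw i).le (by linarith)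
  unfold gainProb
  rw [h1]
  nlinarith

section Gain

variable {n : ℕ} [NeZero n] {w₀ : Fin n → ℝ} {γ η : ℝ}

theorem sum_gainWeight_pos (hw : ∀ i, 0 < w₀ i) (G : Fin n → ℝ) :
    0 < ∑ i, gainWeight w₀ η G i :=
  Finset.sum_pos (fun i _ => gainWeight_pos hw G i) Finset.univ_nonempty

theorem le_gainProb (hw : ∀ i, 0 < w₀ i) (hγ : γ ≤ 1) (G : Fin n → ℝ) (i : Fin n) :
    γ / n ≤ gainProb w₀ γ η G i := by
  have := div_nonneg (gainWeight_pos (η := η) hw G i).le (sum_gainWeight_pos (η := η) hw G).le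
  have := mul_nonneg (sub_nonneg.2 hγ) this
  unfold gainProb
  linarith

theorem sum_gainProb (hw : ∀ i, 0 < w₀ i) (G : Fin n → ℝ) : ∑ i, gainProb w₀ γ η G i = 1 := by
  have hn : (n : ℝ) ≠ 0 := Nat.cast_ne_zero.2 (NeZero.ne n)
  simp only [gainProb]
  rw [Finset.sum_add_distrib, ← Finset.mul_sum, ← Finset.sum_div,
    div_self (sum_gainWeight_pos hw G).ne']
  simp only [Finset.sum_const, Finset.card_univ, Fintype.card_fin, nsmul_eq_mul]
  field_simp
  ring

theorem gainProb_mem_stdSimplex (hw : ∀ i, 0 < w₀ i) (hγ₀ : 0 ≤ γ) (hγ : γ ≤ 1)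
    (G : Fin n → ℝ) : gainProb w₀ γ η G ∈ stdSimplex ℝ (Fin n) :=
  ⟨fun i => (div_nonneg hγ₀ n.cast_nonneg).trans (le_gainProb hw hγ G i), sum_gainProb hw G⟩

/-- One step of the usual potential argument: the logarithm of the total weight grows by about η
times the gain, up to a second-order term. -/
theorem log_sum_gainWeight_le (hw : ∀ i, 0 < w₀ i) (hγ₀ : 0 < γ) (hγ : γ < 1) (hη : η = γ / n)
    (G : Fin n → ℝ) (a : Fin n) {g : ℝ} (hg₀ : 0 ≤ g) (hg : g ≤ 1) :
    Real.log (∑ i, gainWeight w₀ η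
        (fun i => G i + if i = a then g / gainProb w₀ γ η G i else 0) i)
      ≤ Real.log (∑ i, gainWeight w₀ η G i)
        + η / (1 - γ) * (g + η / gainProb w₀ γ η G a) := by
  set W := ∑ i, gainWeight w₀ η G i with hW
  have hWpos : 0 < W := sum_gainWeight_pos hw G
  have hn : (0 : ℝ) < n := Nat.cast_pos.2 (NeZero.pos n)
  have hηpos : 0 < η := by rw [hη]; positivity
  set p := gainProb w₀ γ η G a with hp
  -- Exploration keeps every probability above γ / n = η, so the exponent y is at most 1 and exp y ≤
  -- 1 + y + y² applies.
  have hpη : η ≤ p := by rw [hη]; exact hη ▸ le_gainProb hw hγ.le G a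
  have hppos : 0 < p := hηpos.trans_le hpη
  set y := η * (g / p) with hy
  have hy₀ : 0 ≤ y := by positivity
  have hy₁ : y ≤ 1 := by
    rw [hy, ← mul_div_assoc, div_le_one hppos]
    nlinarith
  set q := gainWeight w₀ η G a / W with hq
  have hq₀ : 0 < q := div_pos (gainWeight_pos hw G a) hWpos
  have hqp : (1 - γ) * q ≤ p := by
    have : 0 ≤ γ / n := by positivity
    rw [hp, gainProb, hq]
    linarith
  have hsum : ∑ i, gainWeight w₀ η (fun i => G i + if i = a then g / gainProb w₀ γ η G i else 0) i
      = W * (1 + q * (Real.exp y - 1)) := by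
    have : ∀ i, gainWeight w₀ η (fun i => G i + if i = a then g / gainProb w₀ γ η G i else 0) i
        = gainWeight w₀ η G i + if i = a then gainWeight w₀ η G a * (Real.exp y - 1) else 0 := by
      intro i
      split_ifs with h
      · subst h
        simp only [gainWeight, if_true, mul_add, Real.exp_add]
        rw [hy, hp]
        ring
      · simp [gainWeight, h]
    rw [Finset.sum_congr rfl fun i _ => this i, Finset.sum_add_distrib, Finset.sum_ite_eq',
      if_pos (Finset.mem_univ a), ← hW, hq]
    field_simp
  have hexp : Real.exp y - 1 ≤ y + y ^ 2 := by
    have := (abs_le.1 (Real.abs_exp_sub_one_sub_id_le (abs_le.2 ⟨by linarith, hy₁⟩))).2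
    linarith
  have hexp₀ : 0 ≤ Real.exp y - 1 := by linarith [Real.add_one_le_exp y]
  have hfac : 0 < 1 + q * (Real.exp y - 1) := by positivity
  rw [hsum, Real.log_mul hWpos.ne' hfac.ne']
  have h1γ : 0 < 1 - γ := by linarith
  have h1 : Real.log (1 + q * (Real.exp y - 1)) ≤ q * (Real.exp y - 1) := by
    linarith [Real.log_le_sub_one_of_pos hfac]
  have h2 : q * (Real.exp y - 1) ≤ q * (y + y ^ 2) := mul_le_mul_of_nonneg_left hexp hq₀.le
  have h3 : q * (y + y ^ 2) ≤ p / (1 - γ) * (y + y ^ 2) := by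
    refine mul_le_mul_of_nonneg_right ?_ (by positivity)
    rw [le_div_iff₀ h1γ]; linarith
  have h4 : p / (1 - γ) * (y + y ^ 2) = η / (1 - γ) * (g + η * g ^ 2 / p) := by
    rw [hy]; field_simp
  have h5 : η / (1 - γ) * (g + η * g ^ 2 / p) ≤ η / (1 - γ) * (g + η / p) := by
    have : g ^ 2 ≤ 1 := pow_le_one₀ hg₀ hg
    gcongr
    nlinarith
  linarith

/-- The regret bound of the gain-based forecaster, before taking expectations. -/
theorem sum_estimate_le (hw : ∀ i, 0 < w₀ i) (hγ₀ : 0 < γ) (hγ : γ < 1) (hη : η = γ / n)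
    {H : ℕ} {G : ℕ → Fin n → ℝ} {a : ℕ → Fin n} {g : ℕ → ℝ} (hg₀ : ∀ k, 0 ≤ g k)
    (hg : ∀ k, g k ≤ 1)
    (hG : ∀ k < H, ∀ i, G k i = ∑ l ∈ Finset.range k,
      if i = a l then g l / gainProb w₀ γ η (G l) i else 0) (j : Fin n) :
    (1 - γ) * ∑ k ∈ Finset.range H, (if j = a k then g k / gainProb w₀ γ η (G k) j else 0)
      ≤ ∑ k ∈ Finset.range H, (g k + η / gainProb w₀ γ η (G k) (a k))
        + Real.log ((∑ i, w₀ i) / w₀ j) / η := by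
  have hn : (0 : ℝ) < n := Nat.cast_pos.2 (NeZero.pos n)
  have hηpos : 0 < η := by rw [hη]; positivity
  have h1γ : 0 < 1 - γ := by linarith
  have hwsum : 0 < ∑ i, w₀ i := Finset.sum_pos (fun i _ => hw i) Finset.univ_nonempty
  have hlogpos : 0 ≤ Real.log ((∑ i, w₀ i) / w₀ j) := by
    refine Real.log_nonneg ?_
    rw [one_le_div (hw j)]
    exact Finset.single_le_sum (fun i _ => (hw i).le) (Finset.mem_univ j)
  set F : ℕ → Fin n → ℝ := fun k i => ∑ l ∈ Finset.range k,
      if i = a l then g l / gainProb w₀ γ η (G l) i else 0 with hF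
  have key : ∀ h ≤ H, Real.log (∑ i, gainWeight w₀ η (F h) i) ≤ Real.log (∑ i, w₀ i)
      + η / (1 - γ) * ∑ k ∈ Finset.range h, (g k + η / gainProb w₀ γ η (G k) (a k)) := by
    intro h
    induction h with
    | zero => intro _; simp [hF, gainWeight]
    | succ h ih =>
      intro hh
      have hGF : G h = F h := funext (hG h (by omega))
      have := log_sum_gainWeight_le (w₀ := w₀) hw hγ₀ hγ hη (G h) (a h) (hg₀ h) (hg h)
      have hFs : F (h + 1) = fun i => G h i +
          if i = a h then g h / gainProb w₀ γ η (G h) i else 0 := by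
        funext i
        simp only [hF, Finset.sum_range_succ]
        rw [hG h (by omega)]
      rw [hFs, Finset.sum_range_succ, mul_add]
      have ih' := ih (by omega)
      rw [hGF] at this ⊢
      linarith
  have hlow : Real.log (w₀ j) + η * F H j ≤ Real.log (∑ i, gainWeight w₀ η (F H) i) := by
    rw [← Real.log_exp (η * F H j), ← Real.log_mul (hw j).ne' (Real.exp_pos _).ne']
    exact Real.log_le_log (gainWeight_pos hw (F H) j)
      (Finset.single_le_sum (fun k _ => (gainWeight_pos hw (F H) k).le) (Finset.mem_univ j))
  have hk := key H le_rfl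
  have hfin : η * F H j ≤ Real.log ((∑ i, w₀ i) / w₀ j)
      + η / (1 - γ) * ∑ k ∈ Finset.range H, (g k + η / gainProb w₀ γ η (G k) (a k)) := by
    rw [Real.log_div hwsum.ne' (hw j).ne']
    linarith
  have h6 := mul_le_mul_of_nonneg_left hfin (div_nonneg h1γ.le hηpos.le)
  have e1 : (1 - γ) / η * (η * F H j) = (1 - γ) * F H j := by field_simp
  have e2 : ∀ X L : ℝ, (1 - γ) / η * (L + η / (1 - γ) * X) = (1 - γ) * (L / η) + X := by
    intro X L; field_simp
  rw [e1, e2] at h6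
  have h7 : (1 - γ) * (Real.log ((∑ i, w₀ i) / w₀ j) / η) ≤
      Real.log ((∑ i, w₀ i) / w₀ j) / η :=
    mul_le_of_le_one_left (div_nonneg hlogpos hηpos.le) (by linarith)
  linarith

end Gain

/-! ### Exponential weights for losses -/

/-- Exponential weights for losses. -/
noncomputable def hedge {n : ℕ} (η : ℝ) (S : Fin n → ℝ) (j : Fin n) : ℝ :=
  Real.exp (-η * S j) / ∑ k, Real.exp (-η * S k)

section Hedge

variable {n : ℕ} [NeZero n] {η : ℝ}

theorem sum_exp_pos (S : Fin n → ℝ) : 0 < ∑ k, Real.exp (-η * S k) :=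
  Finset.sum_pos (fun _ _ => Real.exp_pos _) Finset.univ_nonempty

theorem hedge_pos (S : Fin n → ℝ) (j : Fin n) : 0 < hedge η S j :=
  div_pos (Real.exp_pos _) (sum_exp_pos S)

theorem sum_hedge (S : Fin n → ℝ) : ∑ j, hedge η S j = 1 := by
  simp only [hedge]
  rw [← Finset.sum_div, div_self (sum_exp_pos S).ne']

-- Follows from exp v ≥ 1 + v + v²/2. Unlike the bound used for gains, it holds for all v ≥ 0, so
-- importance-weighted losses need no lower bound on the probabilities.
theorem exp_neg_le {v : ℝ} (hv : 0 ≤ v) : Real.exp (-v) ≤ 1 - v + v ^ 2 := by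
  have h := Real.quadratic_le_exp_of_nonneg hv
  rw [Real.exp_neg, inv_le_comm₀ (Real.exp_pos v) (by nlinarith [sq_nonneg (v - 1)])]
  refine le_trans ?_ h
  rw [inv_le_iff_one_le_mul₀ (by nlinarith [sq_nonneg (v - 1)])]
  nlinarith [sq_nonneg v, mul_nonneg hv (sq_nonneg v), mul_nonneg hv (sq_nonneg (v - 1)),
    sq_nonneg (v * v), sq_nonneg (v ^ 2 - v)]

theorem log_sum_exp_le (S : Fin n → ℝ) (x : Fin n) {z : ℝ} (hz : 0 ≤ z) (hη : 0 ≤ η) :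
    Real.log (∑ k, Real.exp (-η * (S k + if x = k then z else 0)))
      ≤ Real.log (∑ k, Real.exp (-η * S k)) - η * (hedge η S x * z)
        + η ^ 2 * (hedge η S x * z ^ 2) := by
  set W := ∑ k, Real.exp (-η * S k) with hW
  have hWpos : 0 < W := sum_exp_pos S
  set q := hedge η S x with hq
  have hq₀ : 0 < q := hedge_pos S x
  have hpos : 0 < ∑ k, Real.exp (-η * (S k + if x = k then z else 0)) :=
    sum_exp_pos fun k => S k + if x = k then z else 0
  have hsum : ∑ k, Real.exp (-η * (S k + if x = k then z else 0))
      = W * (1 + q * (Real.exp (-(η * z)) - 1)) := by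
    have : ∀ k, Real.exp (-η * (S k + if x = k then z else 0)) = Real.exp (-η * S k)
        + if x = k then Real.exp (-η * S x) * (Real.exp (-(η * z)) - 1) else 0 := by
      intro k
      split_ifs with h
      · subst h
        rw [mul_add, Real.exp_add, neg_mul η z]; ring
      · simp
    rw [Finset.sum_congr rfl fun i _ => this i, Finset.sum_add_distrib, Finset.sum_ite_eq,
      if_pos (Finset.mem_univ x), ← hW, hq, hedge, ← hW]
    field_simp
  rw [hsum] at hpos ⊢
  have hfac : 0 < 1 + q * (Real.exp (-(η * z)) - 1) := (mul_pos_iff_of_pos_left hWpos).1 hpos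
  rw [Real.log_mul hWpos.ne' hfac.ne']
  have h1 := Real.log_le_sub_one_of_pos hfac
  have h2 := mul_le_mul_of_nonneg_left (exp_neg_le (mul_nonneg hη hz)) hq₀.le
  nlinarith

/-- The regret bound of exponential weights, for losses concentrated on one arm in each round. -/
theorem sum_hedge_le (hη : 0 < η) {S : ℕ → Fin n → ℝ} {x : ℕ → Fin n} {z : ℕ → ℝ}
    (hz : ∀ k, 0 ≤ z k) (hS₀ : ∀ j, S 0 j = 0)
    (hS : ∀ k j, S (k + 1) j = S k j + if x k = j then z k else 0) (H : ℕ) (b : Fin n) :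
    ∑ k ∈ Finset.range H, hedge η (S k) (x k) * z k
      ≤ ∑ k ∈ Finset.range H, (if x k = b then z k else 0) + Real.log n / η
        + η * ∑ k ∈ Finset.range H, hedge η (S k) (x k) * z k ^ 2 := by
  have key : ∀ h, Real.log (∑ k, Real.exp (-η * S h k)) ≤ Real.log n
      - η * ∑ k ∈ Finset.range h, hedge η (S k) (x k) * z k
      + η ^ 2 * ∑ k ∈ Finset.range h, hedge η (S k) (x k) * z k ^ 2 := by
    intro h
    induction h with
    | zero => simp [hS₀]
    | succ h ih =>
      have := log_sum_exp_le (η := η) (S h) (x h) (hz h) hη.le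
      simp only [← hS] at this
      rw [Finset.sum_range_succ, Finset.sum_range_succ]
      linarith
  have hSb : ∀ h, S h b = ∑ k ∈ Finset.range h, (if x k = b then z k else 0) := by
    intro h
    induction h with
    | zero => simp [hS₀]
    | succ h ih => rw [hS, ih, Finset.sum_range_succ]
  have hlow : -η * S H b ≤ Real.log (∑ k, Real.exp (-η * S H k)) := by
    rw [← Real.log_exp (-η * S H b)]
    exact Real.log_le_log (Real.exp_pos _)
      (Finset.single_le_sum (f := fun k => Real.exp (-η * S H k))
        (fun k _ => (Real.exp_pos _).le) (Finset.mem_univ b))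
  rw [← hSb]
  have h1 := key H
  have h2 : η * ∑ k ∈ Finset.range H, hedge η (S k) (x k) * z k ≤ η * (S H b + Real.log n / η
        + η * ∑ k ∈ Finset.range H, hedge η (S k) (x k) * z k ^ 2) := by
    have : η * (Real.log n / η) = Real.log n := by field_simp
    nlinarith
  exact le_of_mul_le_mul_left h2 hη

end Hedge

/-! ### The stationary law of a Markov chain with restarts -/

/-- The stationary law of the Markov chain that, in each step, restarts uniformly with probability
`δ` and otherwise moves according to `Q`. -/
noncomputable def restartLaw {m : ℕ} (δ : ℝ) (Q : Matrix (Fin m) (Fin m) ℝ) : Fin m → ℝ :=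
  Matrix.vecMul (fun _ => δ / m) (1 - (1 - δ) • Q)⁻¹

section RestartLaw

variable {m : ℕ} {δ : ℝ} {Q : Matrix (Fin m) (Fin m) ℝ}

/-- The matrix is strictly diagonally dominant: in each row the diagonal entry exceeds the sum of
the other absolute values by δ. -/
theorem det_restart_ne_zero (hδ₀ : 0 < δ) (hδ : δ ≤ 1) (hQ : ∀ i j, 0 ≤ Q i j)
    (hQs : ∀ i, ∑ j, Q i j = 1) : (1 - (1 - δ) • Q).det ≠ 0 := by
  refine det_ne_zero_of_sum_row_lt_diag fun i => ?_
  have h1 : ∀ j ∈ Finset.univ.erase i, ‖(1 - (1 - δ) • Q) i j‖ = (1 - δ) * Q i j := by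
    intro j hj
    have hij : i ≠ j := (Finset.ne_of_mem_erase hj).symm
    simp only [Matrix.sub_apply, Matrix.one_apply_ne hij, Matrix.smul_apply, smul_eq_mul,
      zero_sub, norm_neg, Real.norm_eq_abs]
    exact abs_of_nonneg (mul_nonneg (by linarith) (hQ i j))
  have h2 : ∑ j ∈ Finset.univ.erase i, Q i j = 1 - Q i i := by
    rw [← hQs i, ← Finset.add_sum_erase _ _ (Finset.mem_univ i)]; ring
  rw [Finset.sum_congr rfl h1, ← Finset.mul_sum, h2]
  simp only [Matrix.sub_apply, Matrix.one_apply_eq, Matrix.smul_apply, smul_eq_mul,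
    Real.norm_eq_abs]
  refine lt_of_lt_of_le ?_ (le_abs_self _)
  nlinarith

theorem restartLaw_eq (hδ₀ : 0 < δ) (hδ : δ ≤ 1) (hQ : ∀ i j, 0 ≤ Q i j)
    (hQs : ∀ i, ∑ j, Q i j = 1) (j : Fin m) :
    restartLaw δ Q j = δ / m + (1 - δ) * ∑ i, restartLaw δ Q i * Q i j := by
  have hdet : IsUnit (1 - (1 - δ) • Q).det :=
    isUnit_iff_ne_zero.2 (det_restart_ne_zero hδ₀ hδ hQ hQs)
  have h : Matrix.vecMul (restartLaw δ Q) (1 - (1 - δ) • Q) = fun _ => δ / m := by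
    rw [restartLaw, Matrix.vecMul_vecMul, Matrix.nonsing_inv_mul _ hdet, Matrix.vecMul_one]
  have hj := congrFun h j
  rw [Matrix.vecMul_sub, Matrix.vecMul_one, Matrix.vecMul_smul, Pi.sub_apply, Pi.smul_apply,
    smul_eq_mul] at hj
  have : Matrix.vecMul (restartLaw δ Q) Q j = ∑ i, restartLaw δ Q i * Q i j := rfl
  rw [this] at hj
  linarith

/-- Summing the stationarity equation gives total mass 1. The absolute values satisfy the same
relation with ≤, so ∑ |p j| ≤ 1 = ∑ p j, which leaves no room for a negative entry. -/
theorem restartLaw_mem_stdSimplex [NeZero m] (hδ₀ : 0 < δ) (hδ : δ ≤ 1)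
    (hQ : ∀ i j, 0 ≤ Q i j) (hQs : ∀ i, ∑ j, Q i j = 1) :
    restartLaw δ Q ∈ stdSimplex ℝ (Fin m) := by
  set p := restartLaw δ Q with hp
  have hm : (m : ℝ) ≠ 0 := Nat.cast_ne_zero.2 (NeZero.ne m)
  have heq := restartLaw_eq hδ₀ hδ hQ hQs
  rw [← hp] at heq
  have hswap (f : Fin m → ℝ) : ∑ j, ∑ i, f i * Q i j = ∑ i, f i := by
    rw [Finset.sum_comm]
    refine Finset.sum_congr rfl fun i _ => ?_
    rw [← Finset.mul_sum, hQs, mul_one]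
  have hu : ∑ _j : Fin m, δ / (m : ℝ) = δ := by
    simp only [Finset.sum_const, Finset.card_univ, Fintype.card_fin, nsmul_eq_mul]
    field_simp
  have hsum : ∑ j, p j = 1 := by
    have : ∑ j, p j = δ + (1 - δ) * ∑ j, p j := by
      conv_lhs => rw [Finset.sum_congr rfl fun j _ => heq j]
      rw [Finset.sum_add_distrib, hu, ← Finset.mul_sum, hswap]
    have h2 : δ * (∑ j, p j - 1) = 0 := by linarith
    rcases mul_eq_zero.1 h2 with h | h <;> linarith
  have habs : ∑ j, |p j| ≤ 1 := by
    have h1 : ∀ j, |p j| ≤ δ / m + (1 - δ) * ∑ i, |p i| * Q i j := by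
      intro j
      have h3 : |∑ i, p i * Q i j| ≤ ∑ i, |p i| * Q i j := by
        refine (Finset.abs_sum_le_sum_abs _ _).trans_eq (Finset.sum_congr rfl fun i _ => ?_)
        rw [abs_mul, abs_of_nonneg (hQ i j)]
      calc |p j| = |δ / m + (1 - δ) * ∑ i, p i * Q i j| := by rw [← heq]
        _ ≤ |δ / m| + |(1 - δ) * ∑ i, p i * Q i j| := abs_add_le _ _
        _ = δ / m + (1 - δ) * |∑ i, p i * Q i j| := by
          rw [abs_of_nonneg (by positivity : 0 ≤ δ / (m : ℝ)), abs_mul,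
            abs_of_nonneg (by linarith : 0 ≤ 1 - δ)]
        _ ≤ _ := by gcongr
    have h2 := Finset.sum_le_sum fun j (_ : j ∈ Finset.univ) => h1 j
    rw [Finset.sum_add_distrib, hu, ← Finset.mul_sum, hswap fun i => |p i|] at h2
    have h3 : δ * ∑ j, |p j| ≤ δ * 1 := by linarith
    exact le_of_mul_le_mul_left h3 hδ₀
  refine ⟨fun j => ?_, hsum⟩
  have h0 : ∀ i ∈ Finset.univ, 0 ≤ |p i| - p i := fun i _ => sub_nonneg.2 (le_abs_self _)
  have h1 : ∑ i, (|p i| - p i) = 0 :=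
    le_antisymm (by rw [Finset.sum_sub_distrib, hsum]; linarith) (Finset.sum_nonneg h0)
  have h2 := (Finset.sum_eq_zero_iff_of_nonneg h0).1 h1 j (Finset.mem_univ j)
  rw [← sub_eq_zero.1 h2]
  exact abs_nonneg _

theorem restartLaw_pos [NeZero m] (hδ₀ : 0 < δ) (hδ : δ ≤ 1) (hQ : ∀ i j, 0 ≤ Q i j)
    (hQs : ∀ i, ∑ j, Q i j = 1) (j : Fin m) : 0 < restartLaw δ Q j := by
  have hm : (0 : ℝ) < m := Nat.cast_pos.2 (NeZero.pos m)
  rw [restartLaw_eq hδ₀ hδ hQ hQs]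
  have := mul_nonneg (sub_nonneg.2 hδ) (Finset.sum_nonneg fun i (_ : i ∈ Finset.univ) =>
    mul_nonneg ((restartLaw_mem_stdSimplex hδ₀ hδ hQ hQs).1 i) (hQ i j))
  positivity

/-- The restart makes the stationary law an explicit rational function of the matrix, through
determinant and adjugate, so no measurable selection is needed. -/
theorem measurable_restartLaw {Y : Type*} [MeasurableSpace Y] {q : Y → Matrix (Fin m) (Fin m) ℝ}
    (hq : ∀ i j, Measurable fun y => q y i j) : Measurable fun y => restartLaw δ (q y) := by
  have hM : Measurable fun y => (fun i j => (1 - (1 - δ) • q y) i j : Fin m → Fin m → ℝ) := by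
    refine measurable_pi_lambda _ fun i => measurable_pi_lambda _ fun j => ?_
    simp only [Matrix.sub_apply, Matrix.smul_apply, smul_eq_mul]
    exact measurable_const.sub (measurable_const.mul (hq i j))
  have hc : Continuous fun M : Fin m → Fin m → ℝ => Matrix.of M := continuous_id
  have hc₁ : Continuous fun M : Fin m → Fin m → ℝ => (Matrix.of M).det := hc.matrix_det
  have hc₂ : ∀ i j, Continuous fun M : Fin m → Fin m → ℝ => (Matrix.of M).adjugate i j :=
    fun i j => hc.matrix_adjugate.matrix_elem i j
  have hdet : Measurable fun y => (1 - (1 - δ) • q y).det := hc₁.measurable.comp hM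
  have hadj : ∀ i j, Measurable fun y => (1 - (1 - δ) • q y).adjugate i j := fun i j =>
    (hc₂ i j).measurable.comp hM
  refine measurable_pi_lambda _ fun j => ?_
  have : (fun y => restartLaw δ (q y) j) = fun y => ∑ i, δ / m *
      (((1 - (1 - δ) • q y).det)⁻¹ * (1 - (1 - δ) • q y).adjugate i j) := by
    funext y
    simp only [restartLaw, Matrix.vecMul, dotProduct, Matrix.inv_def, Ring.inverse_eq_inv',
      Matrix.smul_apply, smul_eq_mul]
  rw [this]
  exact Finset.measurable_sum _ fun i _ => (hdet.inv.mul (hadj i j)).const_mul _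

end RestartLaw

/-! ### Swap regret -/

/-- The law from which the slow player draws an arm: the stationary law for the matrix whose rows
are exponential weights, one row for each arm that might be swapped. -/
noncomputable def swapLaw {m : ℕ} (δ η : ℝ) (S : Fin m → Fin m → ℝ) : Fin m → ℝ :=
  restartLaw δ (fun i j => hedge η (S i) j)

section SwapLaw

variable {m : ℕ} [NeZero m] {δ η : ℝ}

/-- Up to restarts, drawing from this law is the same as drawing a row i from it and then an arm
from row i. This turns the regrets of the rows into swap regret. -/
theorem swapLaw_eq (hδ₀ : 0 < δ) (hδ : δ ≤ 1) (S : Fin m → Fin m → ℝ) (j : Fin m) :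
    swapLaw δ η S j = δ / m + (1 - δ) * ∑ i, swapLaw δ η S i * hedge η (S i) j :=
  restartLaw_eq hδ₀ hδ (fun _ _ => (hedge_pos _ _).le) (fun _ => sum_hedge _) j

theorem swapLaw_mem_stdSimplex (hδ₀ : 0 < δ) (hδ : δ ≤ 1) (S : Fin m → Fin m → ℝ) :
    swapLaw δ η S ∈ stdSimplex ℝ (Fin m) :=
  restartLaw_mem_stdSimplex hδ₀ hδ (fun _ _ => (hedge_pos _ _).le) (fun _ => sum_hedge _)

theorem swapLaw_pos (hδ₀ : 0 < δ) (hδ : δ ≤ 1) (S : Fin m → Fin m → ℝ) (j : Fin m) :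
    0 < swapLaw δ η S j :=
  restartLaw_pos hδ₀ hδ (fun _ _ => (hedge_pos _ _).le) (fun _ => sum_hedge _) j

omit [NeZero m] in
theorem measurable_swapLaw : Measurable (swapLaw (m := m) δ η) := by
  refine measurable_restartLaw fun i j => ?_
  unfold hedge
  fun_prop

/-- The swap regret bound of the slow player, before taking expectations. -/
theorem sum_swap_le (hδ₀ : 0 < δ) (hδ : δ ≤ 1 / 2) (hη : 0 < η) {S : ℕ → Fin m → Fin m → ℝ}
    {x : ℕ → Fin m} {y : ℕ → ℝ} (hy₀ : ∀ k, 0 ≤ y k) (hy : ∀ k, y k ≤ 1)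
    (hS₀ : ∀ i j, S 0 i j = 0)
    (hS : ∀ k i j, S (k + 1) i j = S k i j + swapLaw δ η (S k) i *
      (if x k = j then y k / swapLaw δ η (S k) j else 0)) (φ : Fin m → Fin m) (H : ℕ) :
    ∑ k ∈ Finset.range H, y k
      ≤ ∑ k ∈ Finset.range H, ∑ i, swapLaw δ η (S k) i *
          (if x k = φ i then y k / swapLaw δ η (S k) (φ i) else 0)
        + m * Real.log m / η
        + (δ / m + 2 * η) * ∑ k ∈ Finset.range H, 1 / swapLaw δ η (S k) (x k) := by
  have hδ1 : δ ≤ 1 := by linarith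
  set P : ℕ → Fin m → ℝ := fun k => swapLaw δ η (S k) with hP
  have hPpos : ∀ k j, 0 < P k j := fun k j => swapLaw_pos hδ₀ hδ1 (S k) j
  have hPle : ∀ k j, P k j ≤ 1 := fun k j => by
    have h := swapLaw_mem_stdSimplex (η := η) hδ₀ hδ1 (S k)
    rw [← h.2]
    exact Finset.single_le_sum (fun i _ => h.1 i) (Finset.mem_univ j)
  -- Row i is charged the fraction P k i of the loss estimate, so its regret against φ i measures
  -- the gain of swapping i for φ i.
  have hrow := fun i => sum_hedge_le (η := η) hη (S := fun k => S k i) (x := x)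
    (z := fun k => P k i * (y k / P k (x k)))
    (fun k => mul_nonneg (hPpos k i).le (div_nonneg (hy₀ k) (hPpos k _).le)) (hS₀ i)
    (fun k j => by
      rw [hS]; split_ifs with h
      · subst h; rfl
      · simp) H (φ i)
  have hsum := Finset.sum_le_sum fun i (_ : i ∈ Finset.univ) => hrow i
  rw [Finset.sum_add_distrib, Finset.sum_add_distrib, Finset.sum_comm,
    Finset.sum_comm (s := Finset.univ) (t := Finset.range H), ← Finset.mul_sum,
    Finset.sum_comm (s := Finset.univ) (t := Finset.range H)] at hsum
  have hm : ∑ _i : Fin m, Real.log m / η = m * Real.log m / η := by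
    simp only [Finset.sum_const, Finset.card_univ, Fintype.card_fin, nsmul_eq_mul]; ring
  rw [hm] at hsum
  have hPQ : ∀ k j, (1 - δ) * ∑ i, P k i * hedge η (S k i) j = P k j - δ / m := fun k j => by
    have := swapLaw_eq (η := η) hδ₀ hδ1 (S k) j
    simp only [hP]; linarith
  have hPQ₀ : ∀ k j, 0 ≤ ∑ i, P k i * hedge η (S k i) j := fun k j =>
    Finset.sum_nonneg fun i _ => mul_nonneg (hPpos k i).le (hedge_pos _ _).le
  have hleft : ∀ k, y k - δ / m * (1 / P k (x k))
      ≤ ∑ i, hedge η (S k i) (x k) * (P k i * (y k / P k (x k))) := by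
    intro k
    have e : ∑ i, hedge η (S k i) (x k) * (P k i * (y k / P k (x k)))
        = (∑ i, P k i * hedge η (S k i) (x k)) * (y k / P k (x k)) := by
      rw [Finset.sum_mul]; exact Finset.sum_congr rfl fun i _ => by ring
    rw [e]
    have h1 : P k (x k) - δ / m ≤ ∑ i, P k i * hedge η (S k i) (x k) := by
      nlinarith [hPQ k (x k), hPQ₀ k (x k)]
    have h2 := mul_le_mul_of_nonneg_right h1 (div_nonneg (hy₀ k) (hPpos k (x k)).le)
    have h3 : (P k (x k) - δ / m) * (y k / P k (x k))
        = y k - δ / m * (y k / P k (x k)) := by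
      have := (hPpos k (x k)).ne'
      field_simp
    have h4 : δ / m * (y k / P k (x k)) ≤ δ / m * (1 / P k (x k)) := by
      have := hPpos k (x k)
      have := hy k
      gcongr
    linarith
  -- Here P k i ² ≤ P k i, and the mixture of rows is at most P / (1 - δ) ≤ 2P because δ ≤ 1/2. The
  -- resulting 1 / P k (x k) has a bounded mean, however small P is.
  have hquad : ∀ k, ∑ i, hedge η (S k i) (x k) * (P k i * (y k / P k (x k))) ^ 2
      ≤ 2 * (1 / P k (x k)) := by
    intro k
    have hp := hPpos k (x k)
    have h1 : ∑ i, P k i * hedge η (S k i) (x k) ≤ 2 * P k (x k) := by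
      have : 0 ≤ δ / m := by positivity
      nlinarith [hPQ k (x k), hPQ₀ k (x k)]
    have h2 : ∑ i, hedge η (S k i) (x k) * (P k i * (y k / P k (x k))) ^ 2
        ≤ ∑ i, P k i * hedge η (S k i) (x k) * (1 / P k (x k)) ^ 2 := by
      refine Finset.sum_le_sum fun i _ => ?_
      have hq := hedge_pos (η := η) (S k i) (x k)
      have hi := hPpos k i
      have h3 : P k i ^ 2 ≤ P k i := by nlinarith [hPle k i]
      have h4 : (y k / P k (x k)) ^ 2 ≤ (1 / P k (x k)) ^ 2 := by
        have := hy₀ k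
        have := hy k
        gcongr
      calc _ = hedge η (S k i) (x k) * (P k i ^ 2 * (y k / P k (x k)) ^ 2) := by ring
        _ ≤ hedge η (S k i) (x k) * (P k i * (1 / P k (x k)) ^ 2) := by gcongr
        _ = _ := by ring
    rw [← Finset.sum_mul] at h2
    calc _ ≤ _ := h2
      _ ≤ 2 * P k (x k) * (1 / P k (x k)) ^ 2 := by gcongr
      _ = _ := by field_simp
  have h1 := Finset.sum_le_sum fun k (_ : k ∈ Finset.range H) => hleft k
  have h2 := mul_le_mul_of_nonneg_left
    (Finset.sum_le_sum fun k (_ : k ∈ Finset.range H) => hquad k) hη.le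
  rw [Finset.sum_sub_distrib, ← Finset.mul_sum] at h1
  rw [← Finset.mul_sum] at h2
  have h3 : ∑ k ∈ Finset.range H, ∑ i, (if x k = φ i then P k i * (y k / P k (x k)) else 0)
      = ∑ k ∈ Finset.range H, ∑ i, P k i * (if x k = φ i then y k / P k (φ i) else 0) := by
    refine Finset.sum_congr rfl fun k _ => Finset.sum_congr rfl fun i _ => ?_
    split_ifs with h
    · rw [h]
    · simp
  rw [h3] at hsum
  linarith

end SwapLaw

/-! ### The two players

Rounds are grouped in blocks of length `τ`. -/

/-- The learning rate and exploration rate `1 / √τ`. -/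
noncomputable def rate (τ : ℕ) : ℝ := 1 / √τ

/-- Alice's prior weights, concentrated on the arm `0`, which Bob never plays. -/
noncomputable def prior (m τ : ℕ) (i : Fin (m + 1)) : ℝ := if i = 0 then 1 else 1 / τ

/-- Alice's law, given her estimates of the gains in the current block. -/
noncomputable def lawA (m τ : ℕ) : (Fin (m + 1) → ℝ) → Fin (m + 1) → ℝ :=
  gainProb (prior m τ) (rate τ) (rate τ / (m + 1 : ℕ))

/-- Bob's law at the beginning of a block, given his loss estimates. -/
noncomputable def lawB (m τ : ℕ) : (Fin m → Fin m → ℝ) → Fin m → ℝ :=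
  swapLaw (1 / τ) (rate τ)

section Laws

variable {m τ : ℕ}

theorem rate_pos [NeZero τ] : 0 < rate τ :=
  one_div_pos.2 (Real.sqrt_pos.2 (Nat.cast_pos.2 (NeZero.pos τ)))

theorem rate_le_one [NeZero τ] : rate τ ≤ 1 := by
  have h : (1 : ℝ) ≤ τ := Nat.one_le_cast.2 (NeZero.pos τ)
  exact (div_le_one (Real.sqrt_pos.2 (by linarith))).2 (Real.one_le_sqrt.2 h)

theorem rate_lt_one (hτ : 2 ≤ τ) : rate τ < 1 := by
  have h : (2 : ℝ) ≤ τ := Nat.ofNat_le_cast.2 hτ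
  exact (div_lt_one (Real.sqrt_pos.2 (by linarith))).2 (Real.lt_sqrt_of_sq_lt (by linarith))

theorem prior_pos [NeZero τ] (i : Fin (m + 1)) : 0 < prior m τ i := by
  have : (0 : ℝ) < τ := Nat.cast_pos.2 (NeZero.pos τ)
  unfold prior
  split_ifs <;> positivity

theorem lawA_mem_stdSimplex [NeZero τ] (G : Fin (m + 1) → ℝ) :
    lawA m τ G ∈ stdSimplex ℝ (Fin (m + 1)) :=
  gainProb_mem_stdSimplex prior_pos rate_pos.le rate_le_one G

theorem lawA_pos [NeZero τ] (G : Fin (m + 1) → ℝ) (i : Fin (m + 1)) : 0 < lawA m τ G i :=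
  (div_pos rate_pos (Nat.cast_pos.2 m.succ_pos)).trans_le (le_gainProb prior_pos rate_le_one G i)

theorem lawB_mem_stdSimplex [NeZero m] [NeZero τ] (S : Fin m → Fin m → ℝ) :
    lawB m τ S ∈ stdSimplex ℝ (Fin m) :=
  swapLaw_mem_stdSimplex (one_div_pos.2 (Nat.cast_pos.2 (NeZero.pos τ)))
    ((div_le_one (Nat.cast_pos.2 (NeZero.pos τ))).2 (Nat.one_le_cast.2 (NeZero.pos τ))) S

theorem lawB_pos [NeZero m] [NeZero τ] (S : Fin m → Fin m → ℝ) (j : Fin m) : 0 < lawB m τ S j :=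
  swapLaw_pos (one_div_pos.2 (Nat.cast_pos.2 (NeZero.pos τ)))
    ((div_le_one (Nat.cast_pos.2 (NeZero.pos τ))).2 (Nat.one_le_cast.2 (NeZero.pos τ))) S j

end Laws

/-! ### The two strategies as state machines -/

/-- The index among the arms other than `0`. -/
def predArm {m : ℕ} [NeZero m] (i : Fin (m + 1)) : Fin m := if h : i = 0 then 0 else i.pred h

@[simp]
theorem predArm_succ {m : ℕ} [NeZero m] (j : Fin m) : predArm j.succ = j := by
  simp [predArm]

/-- Alice runs, in each block anew, exponential weights with estimated gains. -/
noncomputable def alice (m τ : ℕ) [NeZero τ] : Machine (m + 1) (Fin (m + 1) → ℝ) where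
  init := 0
  act _ G u := sampler (m + 1) ⟨lawA m τ G, lawA_mem_stdSimplex G⟩ u
  upd t G a l := if (t + 1) % τ = 0 then 0 else
    fun i => G i + if i = a then (1 - (l : ℝ)) / lawA m τ G i else 0
  measurable_act _ := (measurable_sampler (m + 1)).comp
    ((((measurable_gainProb _ _ _).comp measurable_fst).subtype_mk).prodMk measurable_snd)
  measurable_upd t := by
    split_ifs
    · exact measurable_const
    · refine measurable_pi_lambda _ fun i => ?_
      have h1 : Measurable fun p : (Fin (m + 1) → ℝ) × Fin (m + 1) × I => lawA m τ p.1 i :=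
        (measurable_pi_apply i).comp ((measurable_gainProb _ _ _).comp measurable_fst)
      have h2 : Measurable fun p : (Fin (m + 1) → ℝ) × Fin (m + 1) × I => ((p.2.2 : I) : ℝ) :=
        measurable_subtype_coe.comp (measurable_snd.comp measurable_snd)
      refine ((measurable_pi_apply i).comp measurable_fst).add
        (Measurable.ite ?_ ((measurable_const.sub h2).div h1) measurable_const)
      exact (measurable_fst.comp measurable_snd) (measurableSet_singleton i) |>.congr
        (by ext p; simp [eq_comm])

/-- Bob plays a fixed arm other than `0` in each block, drawn from a forecaster with small swap
regret. His state consists of his loss estimates, of the arm of the current block, and of the loss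
suffered in the current block. -/
noncomputable def bob (m τ : ℕ) [NeZero m] [NeZero τ] :
    Machine (m + 1) ((Fin m → Fin m → ℝ) × Fin m × ℝ) where
  init := (0, 0, 0)
  act t z u := if t % τ = 0 then (sampler m ⟨lawB m τ z.1, lawB_mem_stdSimplex z.1⟩ u).succ
    else z.2.1.succ
  upd t z b l :=
    -- The estimates change only in the last round of a block, by the block's mean loss. The running
    -- sum is not reset there; it is read as `0` in the first round of the next block.
    (if (t + 1) % τ = 0 then fun i j => z.1 i j + lawB m τ z.1 i *
        (if predArm b = j then
          (((if t % τ = 0 then 0 else z.2.2) + (l : ℝ)) / τ) / lawB m τ z.1 j else 0)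
      else z.1,
      predArm b, (if t % τ = 0 then 0 else z.2.2) + (l : ℝ))
  measurable_act t := by
    have hsucc : Measurable (Fin.succ : Fin m → Fin (m + 1)) := measurable_of_countable _
    split_ifs
    · exact hsucc.comp ((measurable_sampler m).comp
        (((measurable_swapLaw.comp (measurable_fst.comp measurable_fst)).subtype_mk).prodMk
          measurable_snd))
    · exact hsucc.comp (measurable_fst.comp (measurable_snd.comp measurable_fst))
  measurable_upd t := by
    have hl : ∀ i, Measurable fun p : ((Fin m → Fin m → ℝ) × Fin m × ℝ) × Fin (m + 1) × I =>
        lawB m τ p.1.1 i := fun i =>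
      (measurable_pi_apply i).comp (measurable_swapLaw.comp (measurable_fst.comp measurable_fst))
    have hp : Measurable (predArm : Fin (m + 1) → Fin m) := measurable_of_countable _
    have hb : Measurable fun p : ((Fin m → Fin m → ℝ) × Fin m × ℝ) × Fin (m + 1) × I =>
        predArm p.2.1 := hp.comp (measurable_fst.comp measurable_snd)
    have hs : Measurable fun p : ((Fin m → Fin m → ℝ) × Fin m × ℝ) × Fin (m + 1) × I =>
        (if t % τ = 0 then 0 else p.1.2.2) + ((p.2.2 : I) : ℝ) := by
      refine Measurable.add ?_ (measurable_subtype_coe.comp (measurable_snd.comp measurable_snd))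
      split_ifs
      · exact measurable_const
      · exact measurable_snd.comp (measurable_snd.comp measurable_fst)
    refine Measurable.prodMk ?_ (hb.prodMk hs)
    by_cases h : (t + 1) % τ = 0
    · simp only [h, if_true]
      refine measurable_pi_lambda _ fun i => measurable_pi_lambda _ fun j => ?_
      have h1 : Measurable fun p : ((Fin m → Fin m → ℝ) × Fin m × ℝ) × Fin (m + 1) × I =>
          p.1.1 i j := (measurable_pi_apply j).comp ((measurable_pi_apply i).comp
        (measurable_fst.comp measurable_fst))
      have h2 : Measurable fun p : ((Fin m → Fin m → ℝ) × Fin m × ℝ) × Fin (m + 1) × I =>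
          if predArm p.2.1 = j then
            (((if t % τ = 0 then 0 else p.1.2.2) + ((p.2.2 : I) : ℝ)) / τ) / lawB m τ p.1.1 j
          else 0 :=
        Measurable.ite (hb (measurableSet_singleton j)) ((hs.div_const _).div (hl j))
          measurable_const
      exact h1.add ((hl i).mul h2)
    · simp only [h, if_false]
      exact measurable_fst.comp measurable_fst

section BobRules

variable {m τ : ℕ} [NeZero m] [NeZero τ]

theorem bob_act_start {t : ℕ} (ht : t % τ = 0) (z : (Fin m → Fin m → ℝ) × Fin m × ℝ) (u : I) :
    (bob m τ).act t z u = (sampler m ⟨lawB m τ z.1, lawB_mem_stdSimplex z.1⟩ u).succ := if_pos ht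

theorem bob_act_of_ne {t : ℕ} (ht : t % τ ≠ 0) (z : (Fin m → Fin m → ℝ) × Fin m × ℝ) (u : I) :
    (bob m τ).act t z u = z.2.1.succ := if_neg ht

theorem bob_upd (t : ℕ) (z : (Fin m → Fin m → ℝ) × Fin m × ℝ) (b : Fin (m + 1)) (l : I) :
    (bob m τ).upd t z b l =
      (if (t + 1) % τ = 0 then fun i j => z.1 i j + lawB m τ z.1 i *
          (if predArm b = j then
            (((if t % τ = 0 then 0 else z.2.2) + (l : ℝ)) / τ) / lawB m τ z.1 j else 0)
        else z.1,
        predArm b, (if t % τ = 0 then 0 else z.2.2) + (l : ℝ)) := rfl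

end BobRules

theorem volume_alice_act {m τ : ℕ} [NeZero τ] (t : ℕ) (G : Fin (m + 1) → ℝ) (i : Fin (m + 1)) :
    (volume : Measure I).real {u | (alice m τ).act t G u = i} = lawA m τ G i :=
  volume_sampler _ i

/-- The law of Bob's arm at the beginning of a block. -/
noncomputable def startLaw (m τ : ℕ) (z : (Fin m → Fin m → ℝ) × Fin m × ℝ) (i : Fin (m + 1)) : ℝ :=
  Fin.cases 0 (lawB m τ z.1) i

theorem volume_bob_act {m τ : ℕ} [NeZero m] [NeZero τ] {t : ℕ} (ht : t % τ = 0)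
    (z : (Fin m → Fin m → ℝ) × Fin m × ℝ) (i : Fin (m + 1)) :
    (volume : Measure I).real {u | (bob m τ).act t z u = i} = startLaw m τ z i := by
  simp only [bob_act_start ht]
  induction i using Fin.cases with
  | zero => simp [startLaw, Fin.succ_ne_zero]
  | succ j =>
    simp only [Fin.succ_inj, startLaw, Fin.cases_succ]
    exact volume_sampler ⟨lawB m τ z.1, lawB_mem_stdSimplex z.1⟩ j

theorem mod_block {τ n k : ℕ} (hk : k < τ) : (n * τ + k) % τ = k := by
  rw [Nat.mul_add_mod', Nat.mod_eq_of_lt hk]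

/-! ### Evolution of the estimates along one sample path -/

section Path

variable {m τ : ℕ} [NeZero m] [NeZero τ] (loss : LossSequence (m + 1)) (w : Sample)

/-- Alice's gain estimates before round `t`. -/
noncomputable def estA (m τ : ℕ) [NeZero m] [NeZero τ] (loss : LossSequence (m + 1)) (t : ℕ)
    (w : Sample) : Fin (m + 1) → ℝ := (states (alice m τ) (bob m τ) loss t w).1

/-- Bob's loss estimates before round `t`. -/
noncomputable def estB (m τ : ℕ) [NeZero m] [NeZero τ] (loss : LossSequence (m + 1)) (t : ℕ)
    (w : Sample) : Fin m → Fin m → ℝ := (states (alice m τ) (bob m τ) loss t w).2.1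

/-- Alice's arm in round `t`. -/
noncomputable def playA (m τ : ℕ) [NeZero m] [NeZero τ] (loss : LossSequence (m + 1)) (t : ℕ)
    (w : Sample) : Fin (m + 1) := armA (alice m τ) (bob m τ) loss t w

/-- The index of Bob's arm in round `t`. -/
noncomputable def playB (m τ : ℕ) [NeZero m] [NeZero τ] (loss : LossSequence (m + 1)) (t : ℕ)
    (w : Sample) : Fin m := predArm (armB (alice m τ) (bob m τ) loss t w)

/-- Alice's suffered loss in round `t`. -/
noncomputable def lossA (m τ : ℕ) [NeZero m] [NeZero τ] (loss : LossSequence (m + 1)) (t : ℕ)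
    (w : Sample) : ℝ :=
  sufferedLoss (loss t) (playA m τ loss t w) (playB m τ loss t w).succ

/-- Bob's suffered loss in round `t`. -/
noncomputable def lossB (m τ : ℕ) [NeZero m] [NeZero τ] (loss : LossSequence (m + 1)) (t : ℕ)
    (w : Sample) : ℝ :=
  sufferedLoss (loss t) (playB m τ loss t w).succ (playA m τ loss t w)

/-- Bob never plays arm `0`, so the default value of `predArm` is never met. -/
theorem armB_eq_succ (t : ℕ) :
    armB (alice m τ) (bob m τ) loss t w = (playB m τ loss t w).succ := by
  have : ∃ j : Fin m, armB (alice m τ) (bob m τ) loss t w = j.succ := by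
    rw [armB_eq]
    by_cases ht : t % τ = 0
    · exact ⟨_, bob_act_start ht _ _⟩
    · exact ⟨_, bob_act_of_ne ht _ _⟩
  obtain ⟨j, hj⟩ := this
  rw [playB, hj, predArm_succ]

theorem lossA_mem (t : ℕ) : 0 ≤ lossA m τ loss t w ∧ lossA m τ loss t w ≤ 1 :=
  (sufferedLoss (loss t) (playA m τ loss t w) (playB m τ loss t w).succ).2

theorem lossB_mem (t : ℕ) : 0 ≤ lossB m τ loss t w ∧ lossB m τ loss t w ≤ 1 :=
  (sufferedLoss (loss t) (playB m τ loss t w).succ (playA m τ loss t w)).2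

theorem estA_zero : estA m τ loss 0 w = 0 := rfl

theorem estA_succ (t : ℕ) : estA m τ loss (t + 1) w = if (t + 1) % τ = 0 then 0 else
    fun i => estA m τ loss t w i + if i = playA m τ loss t w then
      (1 - lossA m τ loss t w) / lawA m τ (estA m τ loss t w) i else 0 := by
  rw [estA, states_succ, lossA, ← armB_eq_succ]
  rfl

theorem playB_succ {t : ℕ} (ht : (t + 1) % τ ≠ 0) :
    playB m τ loss (t + 1) w = playB m τ loss t w := by
  rw [playB, armB_eq, bob_act_of_ne ht, predArm_succ, states_succ]
  rfl

theorem estB_succ_of_ne {t : ℕ} (ht : (t + 1) % τ ≠ 0) :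
    estB m τ loss (t + 1) w = estB m τ loss t w := by
  rw [estB, states_succ, bob_upd, if_neg ht]
  rfl

theorem playB_block (n : ℕ) {k : ℕ} (hk : k < τ) :
    playB m τ loss (n * τ + k) w = playB m τ loss (n * τ) w := by
  induction k with
  | zero => rfl
  | succ k ih =>
    rw [← add_assoc, playB_succ loss w (by rw [add_assoc, mod_block hk]; omega), ih (by omega)]

theorem estB_block (n : ℕ) {k : ℕ} (hk : k < τ) :
    estB m τ loss (n * τ + k) w = estB m τ loss (n * τ) w := by
  induction k with
  | zero => rfl
  | succ k ih =>
    rw [← add_assoc, estB_succ_of_ne loss w (by rw [add_assoc, mod_block hk]; omega),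
      ih (by omega)]

theorem blockLoss (n : ℕ) {k : ℕ} (hk : k < τ) :
    (states (alice m τ) (bob m τ) loss (n * τ + k + 1) w).2.2.2
      = ∑ l ∈ Finset.range (k + 1), lossB m τ loss (n * τ + l) w := by
  induction k with
  | zero =>
    rw [add_zero, states_succ, bob_upd, Nat.mul_mod_left]
    simp only [zero_add, add_zero, Finset.sum_range_one, lossB, ← armB_eq_succ, if_true]
    rfl
  | succ k ih =>
    rw [Finset.sum_range_succ, ← ih (by omega), states_succ, bob_upd, mod_block hk,
      if_neg k.succ_ne_zero, lossB, ← armB_eq_succ]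
    rfl

theorem estB_next (n : ℕ) (i j : Fin m) :
    estB m τ loss ((n + 1) * τ) w i j = estB m τ loss (n * τ) w i j +
      lawB m τ (estB m τ loss (n * τ) w) i * (if playB m τ loss (n * τ) w = j then
        ((∑ k ∈ Finset.range τ, lossB m τ loss (n * τ + k) w) / τ)
          / lawB m τ (estB m τ loss (n * τ) w) j else 0) := by
  obtain ⟨k, hk⟩ : ∃ k, τ = k + 1 := ⟨τ - 1, by have := NeZero.pos τ; omega⟩
  have hkτ : k < τ := by omega
  have e : (n + 1) * τ = n * τ + k + 1 := by rw [add_mul, one_mul, add_assoc, ← hk]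
  have h0 : (n * τ + k + 1) % τ = 0 := by rw [← e]; exact Nat.mul_mod_left _ _
  have h1 := blockLoss loss w n hkτ
  rw [← hk] at h1
  rw [← h1, ← playB_block loss w n hkτ, ← estB_block loss w n hkτ, e, estB, states_succ, bob_upd, if_pos h0]
  rfl

theorem estA_block (n : ℕ) {k : ℕ} (hk : k < τ) (i : Fin (m + 1)) :
    estA m τ loss (n * τ + k) w i = ∑ l ∈ Finset.range k,
      if i = playA m τ loss (n * τ + l) w then (1 - lossA m τ loss (n * τ + l) w)
        / lawA m τ (estA m τ loss (n * τ + l) w) i else 0 := by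
  induction k with
  | zero =>
    have : estA m τ loss (n * τ) w = 0 := by
      rcases n with _ | n
      · rw [zero_mul]; exact estA_zero loss w
      · obtain ⟨k, hk⟩ : ∃ k, τ = k + 1 := ⟨τ - 1, by omega⟩
        have e : (n + 1) * τ = n * τ + k + 1 := by rw [add_mul, one_mul, add_assoc, ← hk]
        rw [e, estA_succ, if_pos (by rw [← e]; exact Nat.mul_mod_left _ _)]
    simp [this]
  | succ k ih =>
    rw [← add_assoc, estA_succ, if_neg (by rw [add_assoc, mod_block hk]; omega),
      Finset.sum_range_succ, ← ih (by omega)]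

theorem exists_block (t : ℕ) : ∃ n k, k < τ ∧ t = n * τ + k :=
  ⟨t / τ, t % τ, Nat.mod_lt _ (NeZero.pos τ), (Nat.div_add_mod' t τ).symm⟩

theorem estA_nonneg (t : ℕ) (i : Fin (m + 1)) : 0 ≤ estA m τ loss t w i := by
  obtain ⟨n, k, hk, rfl⟩ := exists_block (τ := τ) t
  rw [estA_block loss w n hk]
  refine Finset.sum_nonneg fun l _ => ?_
  split_ifs
  · exact div_nonneg (sub_nonneg.2 (lossA_mem loss w _).2) (lawA_pos _ _).le
  · exact le_rfl

/-- Bob's arm is the same in the whole block, so whenever Alice chose it in this block she collided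
and her gain was 0. This is why she works with gains. -/
theorem estA_playB (t : ℕ) : estA m τ loss t w (playB m τ loss t w).succ = 0 := by
  obtain ⟨n, k, hk, rfl⟩ := exists_block (τ := τ) t
  rw [estA_block loss w n hk]
  refine Finset.sum_eq_zero fun l hl => ?_
  have hl' : l < τ := (Finset.mem_range.1 hl).trans hk
  split_ifs with h
  · rw [playB_block loss w n hk, ← playB_block loss w n hl'] at h
    rw [lossA, ← h]
    simp [sufferedLoss, unitInterval.le_one']
  · rfl

/-- The probability that Alice collides with Bob. -/
theorem lawA_playB_le (t : ℕ) :
    lawA m τ (estA m τ loss t w) (playB m τ loss t w).succ ≤ 1 / τ + rate τ / (m + 1 : ℕ) := by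
  have h := gainProb_le (w₀ := prior m τ) (γ := rate τ) (η := rate τ / (m + 1 : ℕ))
    (i := (playB m τ loss t w).succ) (j := 0) prior_pos rate_pos.le
    (div_nonneg rate_pos.le (Nat.cast_nonneg _)) (estA_playB loss w t)
    (estA_nonneg loss w t 0) (by simp [prior])
  rwa [prior, if_neg (Fin.succ_ne_zero _)] at h

end Path

/-! ### Expected losses -/

/-- The price of the lopsided prior: weights of at least 1/τ add only log τ to Alice's regret bound.
-/
theorem sum_prior_div_le {m τ : ℕ} [NeZero τ] (i : Fin (m + 1)) :
    Real.log ((∑ j, prior m τ j) / prior m τ i) ≤ Real.log ((m + 1 : ℕ) * τ) := by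
  have hτ : (1 : ℝ) ≤ τ := Nat.one_le_cast.2 (NeZero.pos τ)
  have h1 : ∀ j, prior m τ j ≤ 1 := fun j => by
    unfold prior
    split_ifs
    · exact le_rfl
    · exact (div_le_one (by linarith)).2 hτ
  have h2 : 1 / (τ : ℝ) ≤ prior m τ i := by
    unfold prior
    split_ifs
    · exact (div_le_one (by linarith)).2 hτ
    · exact le_rfl
  have h3 : ∑ j, prior m τ j ≤ (m + 1 : ℕ) := by
    refine (Finset.sum_le_sum fun j _ => h1 j).trans_eq ?_
    simp
  have h4 : 0 < ∑ j, prior m τ j := Finset.sum_pos (fun j _ => prior_pos j) Finset.univ_nonempty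
  refine Real.log_le_log (div_pos h4 (prior_pos i)) ?_
  rw [div_le_iff₀ (prior_pos i)]
  have h5 : 1 ≤ τ * prior m τ i := by
    rw [div_le_iff₀ (by linarith)] at h2; linarith
  nlinarith [(Nat.cast_nonneg (m + 1) : (0 : ℝ) ≤ (m + 1 : ℕ))]

section Expect

variable {m τ : ℕ} [NeZero m] [NeZero τ] (loss : LossSequence (m + 1))

theorem integrable_round (t : ℕ)
    (f : (Fin (m + 1) → ℝ) → (Fin m → Fin m → ℝ) → Fin (m + 1) → Fin m → ℝ) :
    Integrable (fun w => f (estA m τ loss t w) (estB m τ loss t w) (playA m τ loss t w)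
      (playB m τ loss t w)) sampleMeasure :=
  integrable_play (alice m τ) (bob m τ) loss t fun z i j => f z.1 z.2.1 i (predArm j)

theorem integral_alice (t : ℕ)
    (f : (Fin (m + 1) → ℝ) → (Fin m → Fin m → ℝ) → Fin (m + 1) → Fin m → ℝ) :
    ∫ w, f (estA m τ loss t w) (estB m τ loss t w) (playA m τ loss t w)
        (playB m τ loss t w) ∂sampleMeasure
      = ∫ w, ∑ i, lawA m τ (estA m τ loss t w) i * f (estA m τ loss t w) (estB m τ loss t w) i
          (playB m τ loss t w) ∂sampleMeasure :=
  integral_play_alice (alice m τ) (bob m τ) loss (volume_alice_act t)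
    fun z i j => f z.1 z.2.1 i (predArm j)

theorem integral_bob (n : ℕ) (f : (Fin m → Fin m → ℝ) → Fin m → ℝ) :
    ∫ w, f (estB m τ loss (n * τ) w) (playB m τ loss (n * τ) w) ∂sampleMeasure
      = ∫ w, ∑ j, lawB m τ (estB m τ loss (n * τ) w) j * f (estB m τ loss (n * τ) w) j
          ∂sampleMeasure := by
  refine (integral_play_bob (alice m τ) (bob m τ) loss (t := n * τ)
    (volume_bob_act (Nat.mul_mod_left _ _)) fun z j => f z.2.1 (predArm j)).trans ?_
  congr 1
  funext w
  rw [Fin.sum_univ_succ]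
  simp only [startLaw, Fin.cases_zero, Fin.cases_succ, zero_mul, zero_add, predArm_succ]
  rfl

theorem integrable_lossA (t : ℕ) : Integrable (lossA m τ loss t) sampleMeasure :=
  integrable_round loss t fun _ _ i j => sufferedLoss (loss t) i j.succ

theorem integrable_lossB (t : ℕ) : Integrable (lossB m τ loss t) sampleMeasure :=
  integrable_round loss t fun _ _ i j => sufferedLoss (loss t) j.succ i

theorem integrable_playB (t : ℕ) (f : Fin m → ℝ) :
    Integrable (fun w => f (playB m τ loss t w)) sampleMeasure :=
  integrable_round loss t fun _ _ _ j => f j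

theorem integral_one_sub {f : Sample → ℝ} (hf : Integrable f sampleMeasure) :
    ∫ w, (1 - f w) ∂sampleMeasure = 1 - ∫ w, f w ∂sampleMeasure := by
  rw [integral_sub (integrable_const _) hf, integral_const, probReal_univ, one_smul]

theorem integral_inv_lawA (t : ℕ) :
    ∫ w, 1 / lawA m τ (estA m τ loss t w) (playA m τ loss t w) ∂sampleMeasure = (m + 1 : ℕ) := by
  rw [integral_alice loss t fun G _ i _ => 1 / lawA m τ G i]
  have : ∀ w, ∑ i, lawA m τ (estA m τ loss t w) i * (1 / lawA m τ (estA m τ loss t w) i)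
      = (m + 1 : ℕ) := fun w => by
    rw [Finset.sum_congr rfl fun i _ => mul_one_div_cancel (lawA_pos _ i).ne']
    simp
  simp only [this, integral_const, probReal_univ, one_smul]

/-- Alice's gain estimates are unbiased for the arms that Bob does not play. -/
theorem integral_estimate (t : ℕ) {c : Fin m → Fin (m + 1)} (hc : ∀ j, c j ≠ j.succ) :
    ∫ w, (if c (playB m τ loss t w) = playA m τ loss t w then (1 - lossA m τ loss t w)
        / lawA m τ (estA m τ loss t w) (c (playB m τ loss t w)) else 0) ∂sampleMeasure
      = 1 - ∫ w, (loss t (c (playB m τ loss t w)) : ℝ) ∂sampleMeasure := by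
  have h := integral_alice (τ := τ) loss t fun G _ i j =>
    if c j = i then (1 - (sufferedLoss (loss t) i j.succ : ℝ)) / lawA m τ G (c j) else 0
  refine h.trans ?_
  rw [← integral_one_sub (integrable_playB loss t fun j => (loss t (c j) : ℝ))]
  congr 1
  funext w
  simp only [mul_ite, mul_zero, Finset.sum_ite_eq, Finset.mem_univ, if_true]
  rw [mul_div_cancel₀ _ (lawA_pos _ _).ne']
  simp [sufferedLoss, hc]

/-- Alice's expected loss in one block, compared with a reaction to Bob's arm. -/
theorem sum_integral_lossA_le (hτ : 2 ≤ τ) (n : ℕ) {c : Fin m → Fin (m + 1)}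
    (hc : ∀ j, c j ≠ j.succ) :
    ∑ k ∈ Finset.range τ, ∫ w, lossA m τ loss (n * τ + k) w ∂sampleMeasure
      ≤ ∑ k ∈ Finset.range τ, ∫ w, (loss (n * τ + k) (c (playB m τ loss (n * τ + k) w)) : ℝ)
          ∂sampleMeasure
        + 2 * rate τ * τ + (m + 1 : ℕ) / rate τ * Real.log ((m + 1 : ℕ) * τ) := by
  set γ := rate τ with hγ
  have hγ₀ : 0 < γ := rate_pos
  have hγ₁ : γ < 1 := rate_lt_one hτ
  have hm : (0 : ℝ) < (m + 1 : ℕ) := Nat.cast_pos.2 m.succ_pos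
  set η := γ / (m + 1 : ℕ) with hη
  have hη₀ : 0 < η := div_pos hγ₀ hm
  have hpath : ∀ w, (1 - γ) * ∑ k ∈ Finset.range τ,
      (if c (playB m τ loss (n * τ + k) w) = playA m τ loss (n * τ + k) w then
        (1 - lossA m τ loss (n * τ + k) w) / lawA m τ (estA m τ loss (n * τ + k) w)
          (c (playB m τ loss (n * τ + k) w)) else 0)
      ≤ ∑ k ∈ Finset.range τ, ((1 - lossA m τ loss (n * τ + k) w)
          + η * (1 / lawA m τ (estA m τ loss (n * τ + k) w) (playA m τ loss (n * τ + k) w)))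
        + Real.log ((m + 1 : ℕ) * τ) / η := by
    intro w
    -- The comparator is random, but it is constant within the block, as Bob's arm is. The pathwise
    -- bound allows such a choice.
    have h := sum_estimate_le (w₀ := prior m τ) prior_pos hγ₀ hγ₁ hη (H := τ)
      (G := fun k => estA m τ loss (n * τ + k) w) (a := fun k => playA m τ loss (n * τ + k) w)
      (g := fun k => 1 - lossA m τ loss (n * τ + k) w)
      (fun k => sub_nonneg.2 (lossA_mem loss w _).2)
      (fun k => sub_le_self _ (lossA_mem loss w _).1)
      (fun k hk i => estA_block loss w n hk i) (c (playB m τ loss (n * τ) w))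
    have h2 := div_le_div_of_nonneg_right (sum_prior_div_le (m := m) (τ := τ)
      (c (playB m τ loss (n * τ) w))) hη₀.le
    have e : ∀ k ∈ Finset.range τ, playB m τ loss (n * τ + k) w = playB m τ loss (n * τ) w :=
      fun k hk => playB_block loss w n (Finset.mem_range.1 hk)
    have e' : ∀ k ∈ Finset.range τ,
        (if c (playB m τ loss (n * τ + k) w) = playA m τ loss (n * τ + k) w then
          (1 - lossA m τ loss (n * τ + k) w) / lawA m τ (estA m τ loss (n * τ + k) w)
            (c (playB m τ loss (n * τ + k) w)) else 0)
        = (if c (playB m τ loss (n * τ) w) = playA m τ loss (n * τ + k) w then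
          (1 - lossA m τ loss (n * τ + k) w) / lawA m τ (estA m τ loss (n * τ + k) w)
            (c (playB m τ loss (n * τ) w)) else 0) := fun k hk => by rw [e k hk]
    rw [Finset.sum_congr rfl e']
    simp only [mul_one_div]
    exact h.trans (add_le_add le_rfl h2)
  have hest : ∀ k, Integrable (fun w =>
      (if c (playB m τ loss (n * τ + k) w) = playA m τ loss (n * τ + k) w then
        (1 - lossA m τ loss (n * τ + k) w) / lawA m τ (estA m τ loss (n * τ + k) w)
          (c (playB m τ loss (n * τ + k) w)) else 0)) sampleMeasure := fun k =>
    integrable_round loss (n * τ + k) fun G _ i j =>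
      if c j = i then (1 - (sufferedLoss (loss (n * τ + k)) i j.succ : ℝ)) / lawA m τ G (c j) else 0
  have hinv : ∀ k, Integrable (fun w => η * (1 / lawA m τ (estA m τ loss (n * τ + k) w)
      (playA m τ loss (n * τ + k) w))) sampleMeasure := fun k =>
    (integrable_round loss (n * τ + k) fun G _ i _ => 1 / lawA m τ G i).const_mul η
  have hgain : ∀ k, Integrable (fun w => 1 - lossA m τ loss (n * τ + k) w) sampleMeasure :=
    fun k => (integrable_const _).sub (integrable_lossA loss _)
  have hboth : ∀ k, Integrable (fun w => (1 - lossA m τ loss (n * τ + k) w)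
      + η * (1 / lawA m τ (estA m τ loss (n * τ + k) w) (playA m τ loss (n * τ + k) w)))
      sampleMeasure := fun k => (hgain k).add (hinv k)
  have hsum := integrable_finsetSum (Finset.range τ) fun k _ => hboth k
  have hE := integral_mono
    ((integrable_finsetSum (Finset.range τ) fun k _ => hest k).const_mul (1 - γ))
    (hsum.add (integrable_const (Real.log ((m + 1 : ℕ) * τ) / η))) hpath
  simp only [Pi.add_apply] at hE
  rw [integral_const_mul, integral_finsetSum _ fun k _ => hest k,
    integral_add hsum (integrable_const _), integral_finsetSum _ fun k _ => hboth k,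
    integral_const, probReal_univ, one_smul,
    Finset.sum_congr rfl fun k _ => integral_estimate loss (n * τ + k) hc,
    Finset.sum_congr rfl fun k _ => integral_add (hgain k) (hinv k)] at hE
  simp only [integral_const_mul, integral_inv_lawA, integral_one_sub (integrable_lossA loss _)]
    at hE
  rw [Finset.sum_add_distrib, Finset.sum_sub_distrib, Finset.sum_sub_distrib] at hE
  simp only [Finset.sum_const, Finset.card_range, nsmul_eq_mul, mul_one] at hE
  have e1 : η * (m + 1 : ℕ) = γ := by rw [hη]; field_simp
  have e2 : Real.log ((m + 1 : ℕ) * τ) / η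
      = (m + 1 : ℕ) / γ * Real.log ((m + 1 : ℕ) * τ) := by rw [hη]; field_simp
  rw [e1, e2] at hE
  -- The factor 1 - γ leaves -γ times the comparator's loss, which is dropped. It also costs γτ, and
  -- the second-order term costs γτ again; together they give 2γτ.
  have hpos : 0 ≤ ∑ k ∈ Finset.range τ, ∫ w,
      (loss (n * τ + k) (c (playB m τ loss (n * τ + k) w)) : ℝ) ∂sampleMeasure :=
    Finset.sum_nonneg fun k _ => integral_nonneg fun w => (loss (n * τ + k) _).2.1
  nlinarith

/-! ### Bob's expected swap regret under collisions -/

theorem integral_inv_lawB (n : ℕ) :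
    ∫ w, 1 / lawB m τ (estB m τ loss (n * τ) w) (playB m τ loss (n * τ) w) ∂sampleMeasure
      = m := by
  rw [integral_bob loss n fun S j => 1 / lawB m τ S j]
  have : ∀ w, ∑ j, lawB m τ (estB m τ loss (n * τ) w) j *
      (1 / lawB m τ (estB m τ loss (n * τ) w) j) = m := fun w => by
    rw [Finset.sum_congr rfl fun i _ => mul_one_div_cancel (lawB_pos _ i).ne']
    simp
  simp only [this, integral_const, probReal_univ, one_smul]

/-- The weight of arm `i`, times the estimate for arm `j` of the constant loss `1`. -/
noncomputable def swapWeight (m τ : ℕ) (i j : Fin m) (S : Fin m → Fin m → ℝ) (x : Fin m) : ℝ :=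
  lawB m τ S i * if x = j then 1 / lawB m τ S j else 0

theorem swapWeight_nonneg (i j : Fin m) (S : Fin m → Fin m → ℝ) (x : Fin m) :
    0 ≤ swapWeight m τ i j S x := by
  refine mul_nonneg (lawB_pos S i).le ?_
  split_ifs
  · exact (one_div_pos.2 (lawB_pos S j)).le
  · exact le_rfl

/-- Averaging over Bob's arm at the start of the block, the importance weight 1/P(j) cancels the
probability of j and leaves P(i), for every j. -/
theorem integral_swapWeight (n : ℕ) {k : ℕ} (hk : k < τ) (i j : Fin m) :
    ∫ w, swapWeight m τ i j (estB m τ loss (n * τ + k) w) (playB m τ loss (n * τ + k) w)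
        ∂sampleMeasure
      = ∫ w, (if playB m τ loss (n * τ + k) w = i then (1 : ℝ) else 0) ∂sampleMeasure := by
  simp only [estB_block loss _ n hk, playB_block loss _ n hk]
  rw [integral_bob loss n (swapWeight m τ i j),
    integral_bob loss n fun _ x => if x = i then (1 : ℝ) else 0]
  congr 1
  funext w
  have h := (lawB_pos (τ := τ) (estB m τ loss (n * τ) w) j).ne'
  simp only [swapWeight, mul_ite, mul_zero, Finset.sum_ite_eq', Finset.mem_univ, if_true, mul_one]
  field_simp

theorem lossB_le (t : ℕ) (w : Sample) : lossB m τ loss t w ≤ loss t (playB m τ loss t w).succ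
    + if playA m τ loss t w = (playB m τ loss t w).succ then 1 else 0 := by
  unfold lossB sufferedLoss
  by_cases h : playA m τ loss t w = (playB m τ loss t w).succ
  · rw [if_pos h, if_pos h.symm, max_eq_right (unitInterval.le_one')]
    have := (loss t (playB m τ loss t w).succ).2.1
    change (1 : ℝ) ≤ _
    linarith
  · rw [if_neg h, if_neg (Ne.symm h), max_eq_left (unitInterval.nonneg'), add_zero]

/-- Collisions inflate Bob's loss estimates only slightly. -/
theorem integral_swapWeight_mul_lossB_le (n : ℕ) {k : ℕ} (hk : k < τ) (i j : Fin m) :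
    ∫ w, swapWeight m τ i j (estB m τ loss (n * τ + k) w) (playB m τ loss (n * τ + k) w)
        * lossB m τ loss (n * τ + k) w ∂sampleMeasure
      ≤ (loss (n * τ + k) j.succ + (1 / τ + rate τ / (m + 1 : ℕ))) *
        ∫ w, (if playB m τ loss (n * τ + k) w = i then (1 : ℝ) else 0) ∂sampleMeasure := by
  set t := n * τ + k with ht
  set ε := 1 / (τ : ℝ) + rate τ / (m + 1 : ℕ) with hε
  have hH : Integrable (fun w => swapWeight m τ i j (estB m τ loss t w) (playB m τ loss t w))
      sampleMeasure := integrable_round loss t fun _ S _ x => swapWeight m τ i j S x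
  have hcol := integral_alice (τ := τ) loss t fun _ S a x =>
    swapWeight m τ i j S x * if a = x.succ then 1 else 0
  have hcoli : Integrable (fun w => swapWeight m τ i j (estB m τ loss t w) (playB m τ loss t w)
      * if playA m τ loss t w = (playB m τ loss t w).succ then 1 else 0) sampleMeasure :=
    integrable_round loss t fun _ S a x => swapWeight m τ i j S x * if a = x.succ then 1 else 0
  -- The collision bound holds for every value of Bob's arm, so averaging over Alice's arm first
  -- brings in the factor ε before the possibly large weight 1/P(j) is integrated.
  have hcol2 : ∫ w, swapWeight m τ i j (estB m τ loss t w) (playB m τ loss t w)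
      * (if playA m τ loss t w = (playB m τ loss t w).succ then 1 else 0) ∂sampleMeasure
      ≤ ε * ∫ w, swapWeight m τ i j (estB m τ loss t w) (playB m τ loss t w) ∂sampleMeasure := by
    rw [hcol, ← integral_const_mul]
    refine integral_mono ?_ (hH.const_mul ε) fun w => ?_
    · exact integrable_round loss t fun G S _ x => ∑ a, lawA m τ G a *
        (swapWeight m τ i j S x * if a = x.succ then 1 else 0)
    · simp only [mul_ite, mul_one, mul_zero, Finset.sum_ite_eq', Finset.mem_univ, if_true]
      exact mul_le_mul_of_nonneg_right (lawA_playB_le loss w t) (swapWeight_nonneg _ _ _ _)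
  have hle : ∫ w, swapWeight m τ i j (estB m τ loss t w) (playB m τ loss t w)
        * lossB m τ loss t w ∂sampleMeasure
      ≤ ∫ w, ((loss t j.succ : ℝ) * swapWeight m τ i j (estB m τ loss t w) (playB m τ loss t w)
        + swapWeight m τ i j (estB m τ loss t w) (playB m τ loss t w)
      * (if playA m τ loss t w = (playB m τ loss t w).succ then 1 else 0)) ∂sampleMeasure := by
    refine integral_mono (integrable_round loss t fun _ S a x => swapWeight m τ i j S x *
        sufferedLoss (loss t) x.succ a) ((hH.const_mul _).add hcoli) fun w => ?_
    have h1 := mul_le_mul_of_nonneg_left (lossB_le (τ := τ) loss t w)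
      (swapWeight_nonneg (τ := τ) i j (estB m τ loss t w) (playB m τ loss t w))
    refine h1.trans_eq ?_
    rw [mul_add]
    congr 1
    by_cases hx : playB m τ loss t w = j
    · rw [hx, mul_comm]
    · simp [swapWeight, hx]
  rw [integral_add (hH.const_mul _) hcoli, integral_const_mul] at hle
  rw [← integral_swapWeight loss n hk i j, ← ht]
  linarith

/-- Bob's law and arm are frozen within a block, so his block estimate splits into rounds, where
Alice's arm can be averaged out. -/
theorem swap_block_eq (n : ℕ) (i j : Fin m) (w : Sample) :
    lawB m τ (estB m τ loss (n * τ) w) i * (if playB m τ loss (n * τ) w = j then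
        ((∑ k ∈ Finset.range τ, lossB m τ loss (n * τ + k) w) / τ)
          / lawB m τ (estB m τ loss (n * τ) w) j else 0)
      = (∑ k ∈ Finset.range τ, swapWeight m τ i j (estB m τ loss (n * τ + k) w)
        (playB m τ loss (n * τ + k) w) * lossB m τ loss (n * τ + k) w) / τ := by
  have e : ∀ k ∈ Finset.range τ, swapWeight m τ i j (estB m τ loss (n * τ + k) w)
      (playB m τ loss (n * τ + k) w) * lossB m τ loss (n * τ + k) w
      = swapWeight m τ i j (estB m τ loss (n * τ) w) (playB m τ loss (n * τ) w)
        * lossB m τ loss (n * τ + k) w := fun k hk => by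
    rw [estB_block loss w n (Finset.mem_range.1 hk), playB_block loss w n (Finset.mem_range.1 hk)]
  rw [Finset.sum_congr rfl e, ← Finset.mul_sum, swapWeight]
  split_ifs
  · ring
  · simp

theorem integrable_swapWeight_mul_lossB (t : ℕ) (i j : Fin m) :
    Integrable (fun w => swapWeight m τ i j (estB m τ loss t w) (playB m τ loss t w)
      * lossB m τ loss t w) sampleMeasure :=
  integrable_round loss t fun _ S a x => swapWeight m τ i j S x *
    sufferedLoss (loss t) x.succ a

/-- Bob's estimated loss in one block, after a swap of arms. -/
theorem integral_swap_le (n : ℕ) (φ : Fin m → Fin m) :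
    ∫ w, ∑ i, lawB m τ (estB m τ loss (n * τ) w) i *
        (if playB m τ loss (n * τ) w = φ i then
          ((∑ k ∈ Finset.range τ, lossB m τ loss (n * τ + k) w) / τ)
            / lawB m τ (estB m τ loss (n * τ) w) (φ i) else 0) ∂sampleMeasure
      ≤ (∑ k ∈ Finset.range τ, ∫ w,
          (loss (n * τ + k) (φ (playB m τ loss (n * τ + k) w)).succ : ℝ) ∂sampleMeasure) / τ
        + (1 / τ + rate τ / (m + 1 : ℕ)) := by
  have hτ : (0 : ℝ) < τ := Nat.cast_pos.2 (NeZero.pos τ)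
  set ε := 1 / (τ : ℝ) + rate τ / (m + 1 : ℕ) with hε
  have hint := fun k i => integrable_swapWeight_mul_lossB (τ := τ) loss (n * τ + k) i (φ i)
  simp only [swap_block_eq, ← Finset.sum_div]
  simp only [Finset.sum_comm (s := Finset.univ)]
  rw [integral_div, integral_finsetSum _ fun k _ => integrable_finsetSum _ fun i _ => hint k i]
  have hk : ∀ k ∈ Finset.range τ, ∫ w, ∑ i, swapWeight m τ i (φ i)
        (estB m τ loss (n * τ + k) w) (playB m τ loss (n * τ + k) w)
        * lossB m τ loss (n * τ + k) w ∂sampleMeasure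
      ≤ ∫ w, (loss (n * τ + k) (φ (playB m τ loss (n * τ + k) w)).succ : ℝ) ∂sampleMeasure
        + ε := by
    intro k hk
    rw [integral_finsetSum _ fun i _ => hint k i]
    refine (Finset.sum_le_sum fun i _ => integral_swapWeight_mul_lossB_le loss n
      (Finset.mem_range.1 hk) i (φ i)).trans_eq ?_
    -- Weighting the loss of φ i by the probability that Bob plays i, and summing over i, gives the
    -- expected loss of the swapped arm.
    simp only [← integral_const_mul]
    rw [← integral_finsetSum _ fun i _ => (integrable_playB loss (n * τ + k)
      fun x => if x = i then (1 : ℝ) else 0).const_mul _]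
    simp only [mul_ite, mul_one, mul_zero, Finset.sum_ite_eq, Finset.mem_univ, if_true]
    rw [integral_add (integrable_playB loss (n * τ + k)
      fun x => (loss (n * τ + k) (φ x).succ : ℝ)) (integrable_const _), integral_const,
      probReal_univ, one_smul]
  have h := Finset.sum_le_sum hk
  rw [Finset.sum_add_distrib] at h
  simp only [Finset.sum_const, Finset.card_range, nsmul_eq_mul] at h
  rw [div_le_iff₀ hτ, add_mul, div_mul_cancel₀ _ hτ.ne']
  linarith

/-- Bob's expected loss, compared with a swap of his arms. -/
theorem sum_integral_lossB_le (hτ : 2 ≤ τ) (N : ℕ) (φ : Fin m → Fin m) :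
    ∑ n ∈ Finset.range N, ∑ k ∈ Finset.range τ,
        ∫ w, lossB m τ loss (n * τ + k) w ∂sampleMeasure
      ≤ ∑ n ∈ Finset.range N, ∑ k ∈ Finset.range τ, ∫ w,
          (loss (n * τ + k) (φ (playB m τ loss (n * τ + k) w)).succ : ℝ) ∂sampleMeasure
        + τ * (N * (1 / τ + rate τ / (m + 1 : ℕ)) + m * Real.log m / rate τ
          + (1 / τ / m + 2 * rate τ) * (N * m)) := by
  have hτ₀ : (0 : ℝ) < τ := Nat.cast_pos.2 (NeZero.pos τ)
  have hτ₂ : (2 : ℝ) ≤ τ := Nat.ofNat_le_cast.2 hτ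
  have hpath := fun w => sum_swap_le (δ := 1 / (τ : ℝ)) (η := rate τ) (one_div_pos.2 hτ₀)
    (one_div_le_one_div_of_le (by norm_num) hτ₂) rate_pos
    (S := fun n => estB m τ loss (n * τ) w) (x := fun n => playB m τ loss (n * τ) w)
    (y := fun n => (∑ k ∈ Finset.range τ, lossB m τ loss (n * τ + k) w) / τ)
    (fun n => div_nonneg (Finset.sum_nonneg fun k _ => (lossB_mem loss w _).1) hτ₀.le)
    (fun n => (div_le_one hτ₀).2 ((Finset.sum_le_sum fun k _ => (lossB_mem loss w _).2).trans_eq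
      (by simp)))
    (fun i j => by simp only [zero_mul]; rfl) (fun n i j => estB_next loss w n i j) φ N
  have h1 : ∀ n, Integrable (fun w => (∑ k ∈ Finset.range τ, lossB m τ loss (n * τ + k) w) / τ)
      sampleMeasure := fun n =>
    (integrable_finsetSum _ fun k _ => integrable_lossB loss (n * τ + k)).div_const _
  have h2 : ∀ n, Integrable (fun w => ∑ i, lawB m τ (estB m τ loss (n * τ) w) i *
        (if playB m τ loss (n * τ) w = φ i then
          ((∑ k ∈ Finset.range τ, lossB m τ loss (n * τ + k) w) / τ)
            / lawB m τ (estB m τ loss (n * τ) w) (φ i) else 0)) sampleMeasure := by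
    intro n
    refine integrable_finsetSum _ fun i _ => ?_
    simp only [swap_block_eq]
    exact (integrable_finsetSum _ fun k _ =>
      integrable_swapWeight_mul_lossB loss (n * τ + k) i (φ i)).div_const _
  have h3 : ∀ n, Integrable (fun w => 1 / lawB m τ (estB m τ loss (n * τ) w)
      (playB m τ loss (n * τ) w)) sampleMeasure := fun n =>
    integrable_round loss (n * τ) fun _ S _ x => 1 / lawB m τ S x
  have h4 := integrable_finsetSum (Finset.range N) fun n _ => h2 n
  have h5 : Integrable (fun w => ∑ n ∈ Finset.range N, ∑ i, lawB m τ (estB m τ loss (n * τ) w) i *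
        (if playB m τ loss (n * τ) w = φ i then
          ((∑ k ∈ Finset.range τ, lossB m τ loss (n * τ + k) w) / τ)
            / lawB m τ (estB m τ loss (n * τ) w) (φ i) else 0) + m * Real.log m / rate τ)
      sampleMeasure := h4.add (integrable_const _)
  have h6 := (integrable_finsetSum (Finset.range N) fun n _ => h3 n).const_mul
    (1 / τ / m + 2 * rate τ)
  have hE := integral_mono (integrable_finsetSum (Finset.range N) fun n _ => h1 n)
    (h5.add h6) hpath
  simp only [Pi.add_apply] at hE
  rw [integral_finsetSum _ fun n _ => h1 n, integral_add h5 h6,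
    integral_add h4 (integrable_const _), integral_finsetSum _ fun n _ => h2 n,
    integral_const_mul, integral_finsetSum _ fun n _ => h3 n, integral_const, probReal_univ,
    one_smul] at hE
  simp only [integral_inv_lawB, integral_div] at hE
  have h7 := Finset.sum_le_sum fun n (_ : n ∈ Finset.range N) =>
    integral_swap_le (τ := τ) loss n φ
  rw [Finset.sum_add_distrib] at h7
  simp only [Finset.sum_const, Finset.card_range, nsmul_eq_mul] at h7 hE
  rw [Finset.sum_congr rfl fun n _ => by
    rw [integral_finsetSum _ fun k _ => integrable_lossB loss (n * τ + k)]] at hE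
  -- The swap bound concerns mean losses per block; multiplying by τ returns to total losses.
  have h8 := mul_le_mul_of_nonneg_left (hE.trans (add_le_add (add_le_add h7 le_rfl) le_rfl)) hτ₀.le
  rw [← Finset.sum_div, ← Finset.sum_div, mul_div_cancel₀ _ hτ₀.ne'] at h8
  refine h8.trans_eq ?_
  field_simp
  ring

end Expect

/-! ### The regret bound -/

theorem sum_range_mul_block (f : ℕ → ℝ) (N τ : ℕ) :
    ∑ t ∈ Finset.range (N * τ), f t
      = ∑ n ∈ Finset.range N, ∑ k ∈ Finset.range τ, f (n * τ + k) := by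
  induction N with
  | zero => simp
  | succ N ih => rw [Finset.sum_range_succ, ← ih, add_mul, one_mul, Finset.sum_range_add]

/-- Every pair of distinct arms is a swap of Bob's arms together with a reaction of Alice. -/
theorem exists_swap {m : ℕ} {a b : Fin (m + 1)} (hab : a ≠ b) :
    ∃ (φ : Fin m → Fin m) (c : Fin m → Fin (m + 1)), (∀ j, c j ≠ j.succ) ∧
      ∀ (f : Fin (m + 1) → ℝ) j, f (c j) + f (φ j).succ = f a + f b := by
  induction a using Fin.cases with
  | zero =>
    obtain ⟨b, rfl⟩ := Fin.exists_succ_eq.2 hab.symm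
    exact ⟨fun _ => b, fun _ => 0, fun j => (Fin.succ_ne_zero j).symm, fun _ _ => rfl⟩
  | succ a =>
    induction b using Fin.cases with
    | zero =>
      exact ⟨fun _ => a, fun _ => 0, fun j => (Fin.succ_ne_zero j).symm, fun _ _ => add_comm _ _⟩
    | succ b =>
      refine ⟨fun j => if j = a then a else b, fun j => if j = a then b.succ else a.succ,
        fun j => ?_, fun f j => ?_⟩
      · dsimp only
        split_ifs with h
        · subst h; exact hab.symm
        · exact fun h' => h (Fin.succ_injective _ h').symm
      · dsimp only
        split_ifs
        · exact add_comm _ _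
        · rfl

section Regret

variable {m τ : ℕ} [NeZero m] [NeZero τ] (loss : LossSequence (m + 1))

theorem excessLoss_pairStrategy (T : ℕ) (a b : Fin (m + 1)) (w : Sample) :
    excessLoss (pairStrategy (alice m τ) (bob m τ)) loss T a b w
      = ∑ t ∈ Finset.range T, (lossA m τ loss t w + lossB m τ loss t w
        - ((loss t a : ℝ) + loss t b)) := by
  refine Finset.sum_congr rfl fun t _ => ?_
  rw [lossA, lossB, ← armB_eq_succ]
  rfl

theorem integral_excessLoss_le (hτ : 2 ≤ τ) {a b : Fin (m + 1)} (hab : a ≠ b) :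
    ∫ w, excessLoss (pairStrategy (alice m τ) (bob m τ)) loss (τ * τ) a b w ∂sampleMeasure
      ≤ τ * (2 * rate τ * τ + (m + 1 : ℕ) / rate τ * Real.log ((m + 1 : ℕ) * τ))
        + τ * (τ * (1 / τ + rate τ / (m + 1 : ℕ)) + m * Real.log m / rate τ
          + (1 / τ / m + 2 * rate τ) * (τ * m)) := by
  obtain ⟨φ, c, hc, hsum⟩ := exists_swap hab
  have hA := Finset.sum_le_sum fun n (_ : n ∈ Finset.range τ) =>
    sum_integral_lossA_le (τ := τ) loss hτ n hc
  have hB := sum_integral_lossB_le loss hτ τ φ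
  simp only [Finset.sum_add_distrib, Finset.sum_const, Finset.card_range, nsmul_eq_mul] at hA
  simp only [← sum_range_mul_block (fun t => ∫ w, lossA m τ loss t w ∂sampleMeasure),
    ← sum_range_mul_block (fun t => ∫ w, (loss t (c (playB m τ loss t w)) : ℝ) ∂sampleMeasure)]
    at hA
  simp only [← sum_range_mul_block (fun t => ∫ w, lossB m τ loss t w ∂sampleMeasure),
    ← sum_range_mul_block
      (fun t => ∫ w, (loss t (φ (playB m τ loss t w)).succ : ℝ) ∂sampleMeasure)] at hB
  -- Each comparator depends on Bob's random arm, but their sum does not.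
  have hc' : ∀ t, ∫ w, (loss t (c (playB m τ loss t w)) : ℝ) ∂sampleMeasure
      + ∫ w, (loss t (φ (playB m τ loss t w)).succ : ℝ) ∂sampleMeasure
      = (loss t a : ℝ) + loss t b := by
    intro t
    rw [← integral_add (integrable_playB loss t fun j => (loss t (c j) : ℝ))
      (integrable_playB loss t fun j => (loss t (φ j).succ : ℝ))]
    have := hsum fun i => (loss t i : ℝ)
    simp only [this, integral_const, probReal_univ, one_smul]
  have hi : ∀ t, Integrable (fun w => lossA m τ loss t w + lossB m τ loss t w
      - ((loss t a : ℝ) + loss t b)) sampleMeasure := fun t =>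
    ((integrable_lossA loss t).add (integrable_lossB loss t)).sub (integrable_const _)
  have hterm : ∀ t, ∫ w, (lossA m τ loss t w + lossB m τ loss t w
      - ((loss t a : ℝ) + loss t b)) ∂sampleMeasure
      = ∫ w, lossA m τ loss t w ∂sampleMeasure + ∫ w, lossB m τ loss t w ∂sampleMeasure
        - (∫ w, (loss t (c (playB m τ loss t w)) : ℝ) ∂sampleMeasure
          + ∫ w, (loss t (φ (playB m τ loss t w)).succ : ℝ) ∂sampleMeasure) := by
    intro t
    have hAB : Integrable (fun w => lossA m τ loss t w + lossB m τ loss t w) sampleMeasure :=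
      (integrable_lossA loss t).add (integrable_lossB loss t)
    rw [hc', integral_sub hAB (integrable_const _), integral_add (integrable_lossA loss t)
      (integrable_lossB loss t), integral_const, probReal_univ, one_smul]
  simp only [excessLoss_pairStrategy]
  rw [integral_finsetSum _ fun t _ => hi t, Finset.sum_congr rfl fun t _ => hterm t,
    Finset.sum_sub_distrib, Finset.sum_add_distrib, Finset.sum_add_distrib]
  linarith

end Regret

/-! ### Truncation from τ² to T rounds, and the constants -/

/-- A round contributes at least -2, so playing on until the blocks are complete hides at most 2 per
additional round. -/
theorem excessLoss_le {m : ℕ} (loss : LossSequence (m + 1)) {T T' : ℕ} (hT : T ≤ T') (S : TwoPlayerStrategy (m + 1))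
    (a b : Fin (m + 1)) (w : Sample) :
    excessLoss S loss T a b w ≤ excessLoss S loss T' a b w + 2 * (T' - T : ℕ) := by
  obtain ⟨d, rfl⟩ := Nat.exists_eq_add_of_le hT
  simp only [excessLoss, Finset.sum_range_add, Nat.add_sub_cancel_left]
  have : ∑ t ∈ Finset.range d, (-2 : ℝ) ≤ ∑ t ∈ Finset.range d,
      ((sufferedLoss (loss (T + t)) (aliceArm S loss (T + t) w) (bobArm S loss (T + t) w) : ℝ)
      + (sufferedLoss (loss (T + t)) (bobArm S loss (T + t) w) (aliceArm S loss (T + t) w) : ℝ)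
      - ((loss (T + t) a : ℝ) + (loss (T + t) b : ℝ))) := by
    refine Finset.sum_le_sum fun t _ => ?_
    have h1 := (sufferedLoss (loss (T + t)) (aliceArm S loss (T + t) w)
      (bobArm S loss (T + t) w)).2.1
    have h2 := (sufferedLoss (loss (T + t)) (bobArm S loss (T + t) w)
      (aliceArm S loss (T + t) w)).2.1
    have h3 := (loss (T + t) a).2.2
    have h4 := (loss (T + t) b).2.2
    linarith
  simp only [Finset.sum_const, Finset.card_range, nsmul_eq_mul] at this
  linarith

theorem block_error_le {m τ : ℕ} [NeZero m] (hτ : 2 ≤ τ) :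
    τ * (2 * rate τ * τ + (m + 1 : ℕ) / rate τ * Real.log ((m + 1 : ℕ) * τ))
        + τ * (τ * (1 / τ + rate τ / (m + 1 : ℕ)) + m * Real.log m / rate τ
          + (1 / τ / m + 2 * rate τ) * (τ * m))
      ≤ 8 * ((m + 1 : ℕ) * Real.log ((m + 1 : ℕ) * τ)) * √τ ^ 3 := by
  have hm : (1 : ℝ) ≤ m := Nat.one_le_cast.2 (NeZero.pos m)
  have hτ₂ : (2 : ℝ) ≤ τ := Nat.ofNat_le_cast.2 hτ
  set s := √(τ : ℝ) with hs
  have hs₁ : 1 ≤ s := Real.one_le_sqrt.2 (by linarith)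
  have hs₀ : 0 < s := by linarith
  have hsτ : (τ : ℝ) = s ^ 2 := (Real.sq_sqrt (by linarith)).symm
  have hrate : rate τ = 1 / s := rfl
  set L := Real.log ((m + 1 : ℕ) * τ) with hL
  have hcast : ((m + 1 : ℕ) : ℝ) = m + 1 := by push_cast; rfl
  -- (m + 1) τ ≥ 4 > e. This lets L absorb all terms without a logarithm.
  have hL₁ : 1 ≤ L := by
    rw [hL, hcast, Real.le_log_iff_exp_le (by positivity)]
    have := Real.exp_one_lt_d9
    nlinarith
  have hLm : Real.log m ≤ L := by
    rw [hL, hcast]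
    exact Real.log_le_log (by linarith) (by nlinarith)
  rw [hrate, hcast, hsτ]
  have e1 : s ^ 2 * (2 * (1 / s) * s ^ 2 + ((m : ℝ) + 1) / (1 / s) * L)
      + s ^ 2 * (s ^ 2 * (1 / s ^ 2 + 1 / s / ((m : ℝ) + 1)) + m * Real.log m / (1 / s)
        + (1 / s ^ 2 / m + 2 * (1 / s)) * (s ^ 2 * m))
      = (2 + (m + 1) * L + 1 / ((m : ℝ) + 1) + m * Real.log m + 2 * m) * s ^ 3 + 2 * s ^ 2 := by
    field_simp
    ring
  rw [e1]
  have h1 : s ^ 2 ≤ s ^ 3 := pow_le_pow_right₀ hs₁ (by norm_num)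
  have h2 : 1 / ((m : ℝ) + 1) ≤ 1 := (div_le_one (by linarith)).2 (by linarith)
  have h3 : (m : ℝ) * Real.log m ≤ m * L := mul_le_mul_of_nonneg_left hLm (by linarith)
  have h4 : (m : ℝ) + 1 ≤ (m + 1) * L := le_mul_of_one_le_right (by linarith) hL₁
  have h5 : 2 + (m + 1) * L + 1 / ((m : ℝ) + 1) + m * Real.log m + 2 * m + 2
      ≤ 8 * ((m + 1) * L) := by nlinarith
  have h6 := mul_le_mul_of_nonneg_right h5 (by positivity : 0 ≤ s ^ 3)
  linarith


/-- With x = T^{1/4} and Λ = log(KT), the first term is at most 8 · 2 · 3 = 48 times K Λ x³. The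
truncation costs at most 6 x³ ≤ 6 K Λ x³, since K Λ ≥ 1. So 60 is enough. -/
theorem rate_bound {K T τ : ℕ} (hK : 2 ≤ K) (hT : 1 ≤ T) (hτ : τ = Nat.sqrt T + 1) :
    8 * (K * Real.log (K * τ)) * √τ ^ 3 + 2 * (τ * τ - T : ℕ)
      ≤ 60 * ((K : ℝ) * (T : ℝ) ^ (3 / 4 : ℝ)) * Real.log ((K : ℝ) * (T : ℝ)) ^ 1 := by
  have hK' : (2 : ℝ) ≤ K := Nat.ofNat_le_cast.2 hK
  have hT' : (1 : ℝ) ≤ T := Nat.one_le_cast.2 hT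
  set x : ℝ := (T : ℝ) ^ (1 / 4 : ℝ) with hx
  have hx₁ : 1 ≤ x := Real.one_le_rpow hT' (by norm_num)
  have hx3 : (T : ℝ) ^ (3 / 4 : ℝ) = x ^ 3 := by
    rw [hx, ← Real.rpow_natCast, ← Real.rpow_mul (by linarith)]; norm_num
  have hx4 : (T : ℝ) = x ^ 4 := by
    rw [hx, ← Real.rpow_natCast, ← Real.rpow_mul (by linarith)]; norm_num
  have hsq : (Nat.sqrt T : ℝ) ≤ x ^ 2 := by
    refine (Real.nat_sqrt_le_real_sqrt (a := T)).trans_eq ?_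
    rw [hx4, show x ^ 4 = (x ^ 2) ^ 2 by ring, Real.sqrt_sq (by positivity)]
  have hτx : (τ : ℝ) ≤ 2 * x ^ 2 := by
    rw [hτ]; push_cast; nlinarith
  have hs : √(τ : ℝ) ≤ 3 / 2 * x := by
    rw [Real.sqrt_le_left (by linarith)]; nlinarith
  have hs3 : √(τ : ℝ) ^ 3 ≤ 3 * x ^ 3 := by
    have e : √(τ : ℝ) ^ 3 = τ * √τ := by
      rw [pow_succ, Real.sq_sqrt (Nat.cast_nonneg _)]
    rw [e]
    calc (τ : ℝ) * √τ ≤ 2 * x ^ 2 * (3 / 2 * x) := by gcongr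
      _ = 3 * x ^ 3 := by ring
  have hd : ((τ * τ - T : ℕ) : ℝ) ≤ 3 * x ^ 3 := by
    have h1 : τ * τ - T ≤ 2 * Nat.sqrt T + 1 := by
      have := Nat.sqrt_le' T
      rw [hτ, Nat.sub_le_iff_le_add]; nlinarith
    have h2 : ((τ * τ - T : ℕ) : ℝ) ≤ 2 * (Nat.sqrt T : ℝ) + 1 := by exact_mod_cast h1
    have h3 : x ^ 2 ≤ x ^ 3 := pow_le_pow_right₀ hx₁ (by norm_num)
    nlinarith
  set Λ := Real.log ((K : ℝ) * T) with hΛ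
  have hΛ₀ : 1 / 2 ≤ Λ := by
    have h1 : Real.log 2 ≤ Λ := Real.log_le_log (by norm_num) (by nlinarith)
    have := Real.log_two_gt_d9
    linarith
  have hlog : Real.log (K * τ) ≤ 2 * Λ := by
    -- τ ≤ T + 1 ≤ 2T, and K ≥ 2.
    have h1 : (τ : ℝ) ≤ K * T := by
      have : (Nat.sqrt T : ℝ) ≤ T := by exact_mod_cast Nat.sqrt_le_self T
      rw [hτ]; push_cast; nlinarith
    have h2 : (K : ℝ) * τ ≤ (K * T) ^ 2 := by
      have h3 : (K : ℝ) ≤ K * T := by nlinarith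
      nlinarith
    have h4 : (0 : ℝ) < τ := by rw [hτ]; positivity
    calc Real.log (K * τ) ≤ Real.log ((K * T) ^ 2) := Real.log_le_log (by positivity) h2
      _ = 2 * Λ := by rw [Real.log_pow, hΛ]; norm_num
  have h1 : 8 * (K * Real.log (K * τ)) * √(τ : ℝ) ^ 3 ≤ 8 * (K * (2 * Λ)) * (3 * x ^ 3) := by
    have : (0 : ℝ) ≤ 8 * (K * (2 * Λ)) := by positivity
    gcongr
  have h2 : x ^ 3 ≤ K * Λ * x ^ 3 := by
    refine le_mul_of_one_le_left (by positivity) ?_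
    nlinarith
  rw [hx3, pow_one]
  nlinarith

end TwoPlayerBandit

theorem mainTheorem3 :
    ∃ (C : ℝ) (p : ℕ), ∀ (K T : ℕ), 2 ≤ K → 1 ≤ T →
      ∃ S : TwoPlayerBandit.TwoPlayerStrategy K, ∀ loss : TwoPlayerBandit.LossSequence K,
        TwoPlayerBandit.regret S loss T
          ≤ C * ((K : ℝ) * (T : ℝ) ^ (3 / 4 : ℝ)) * Real.log ((K : ℝ) * (T : ℝ)) ^ p := by
  refine ⟨60, 1, fun K T hK hT => ?_⟩
  obtain ⟨m, rfl⟩ : ∃ m, K = m + 1 := ⟨K - 1, by omega⟩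
  have : NeZero m := ⟨by omega⟩
  obtain ⟨τ, hτ⟩ : ∃ τ, τ = Nat.sqrt T + 1 := ⟨_, rfl⟩
  have hτ₂ : 2 ≤ τ := by
    have := Nat.sqrt_pos.2 hT
    omega
  have : NeZero τ := ⟨by omega⟩
  have hTτ : T ≤ τ * τ := by rw [hτ]; exact (Nat.lt_succ_sqrt T).le
  refine ⟨TwoPlayerBandit.pairStrategy (TwoPlayerBandit.alice m τ) (TwoPlayerBandit.bob m τ),
    fun loss => ?_⟩
  have : Nonempty {p : Fin (m + 1) × Fin (m + 1) // p.1 ≠ p.2} :=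
    ⟨⟨(0, Fin.succ 0), (Fin.succ_ne_zero (0 : Fin m)).symm⟩⟩
  refine ciSup_le fun p => ?_
  refine le_trans ?_ (TwoPlayerBandit.rate_bound hK hT hτ)
  refine le_trans (integral_mono (TwoPlayerBandit.integrable_excessLoss _ loss T _ _)
    ((TwoPlayerBandit.integrable_excessLoss _ loss (τ * τ) _ _).add
      (integrable_const (2 * ((τ * τ - T : ℕ) : ℝ))))
    fun w => TwoPlayerBandit.excessLoss_le loss hTτ _ _ _ w) ?_
  simp only [Pi.add_apply]
  rw [integral_add (TwoPlayerBandit.integrable_excessLoss _ loss (τ * τ) _ _) (integrable_const _),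
    integral_const, probReal_univ, one_smul]
  exact add_le_add ((TwoPlayerBandit.integral_excessLoss_le loss hτ₂ p.2).trans
    (TwoPlayerBandit.block_error_le hτ₂)) le_rfl
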